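/- Let $\alpha\in(0,2)$, let $a,b\in(0,+\infty)$, and let $\nu_1,\nu_2$ be Borel probability measures on the unit circle $\mathbb S^1\subset\mathbb C$, with supports $\mathrm{supp}(\nu_1),\mathrm{supp}(\nu_2)$. Let $H_n(\mathbb C)$ be the set of Hermitian $n\times n$ matrices. For $A\in H_n(\mathbb C)$, $n\ge1$, let $\lambda_A$ be its largest eigenvalue and $$I(A)=b\sum_{i}|A_{i,i}|^{\alpha}+a\sum_{i<j}|A_{i,j}|^{\alpha}.$$ Let $\mathcal D$ be the set of all $A\in\bigcup_{n\ge1}H_n(\mathbb C)$ such that, for all $i\le j$, either $A_{i,j}=0$ or $A_{i,j}/|A_{i,j}|\in\mathrm{supp}(\nu_{i,j})$, where $\nu_{i,i}=\nu_1$ and $\nu_{i,j}=\nu_2$ for $i<j$. Put $$c=\inf\{I(A): A\in\mathcal D,\ \lambda_A=1\}.$$ For $n\ge1$ and real $s,t\ge 0$ with $s+(n-1)t\neq0$, let $B^{(n)}(s,t)$ be the $n\times n$ matrix whose diagonal entries are $\frac{s}{s+(n-1)t}$ and whose off-diagonal entries are $\frac{t}{s+(n-1)t}$. **(a)** If $\alpha\le1$,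 then $c=\min(a,b)$ if $1\in\mathrm{supp}(\nu_1)$, and $c=a$ otherwise. **(b)** If $1<\alpha<2$, $1\in\mathrm{supp}(\nu_1)$ and $b\le a/2$, then $c=b$. **(c)** Suppose $1<\alpha<2$, $1\in\mathrm{supp}(\nu_1)\cap\mathrm{supp}(\nu_2)$ and $b>a/2$. Put $s=(1/b)^{1/(\alpha-1)}$ and $t=(2/a)^{1/(\alpha-1)}$. Then for every $n\ge1$ the matrix $B^{(n)}(s,t)$ belongs to $\mathcal D$ and has largest eigenvalue $1$, and $$c=\min\{I(B^{(n)}(s,t)):n\ge1\},$$ where the minimum is attained. Moreover $$c=\min\bigl(\psi(\max(1,\lfloor t_0\rfloor)),\,\psi(\lceil t_0\rceil)\bigr),$$ where $$\psi(x)=\frac{x}{\bigl((1/b)^{1/(\alpha-1)}+(x-1)(2/a)^{1/(\alpha-1)}\bigr)^{\alpha-1}}\quad(x\ge1),\qquad t_0=\frac1{2-\alpha}\Bigl(1-\Bigl(\frac a{2b}\Bigr)^{1/(\alpha-1)}\Bigr).$$ **(d)** If $1<\alpha<2$, $1\in\mathrm{supp}(\nu_1)$, $\mathrm{supp}(\nu_2)=\{-1\}$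 and $b>a/2$, then $$c=\min\left(b,\ \frac{2}{\bigl((1/b)^{1/(\alpha-1)}+(2/a)^{1/(\alpha-1)}\bigr)^{\alpha-1}}\right).$$ **(e)** If $1<\alpha<2$, $\mathrm{supp}(\nu_1)=\{-1\}$ and $1\in\mathrm{supp}(\nu_2)$, then for every $n\ge2$ the matrix $B^{(n)}(0,1)$ belongs to $\mathcal D$ and has largest eigenvalue $1$, and $$c=\min\{I(B^{(n)}(0,1)):n\ge2\}=\frac a2\min\bigl(\phi(\max(2,\lfloor t_1\rfloor)),\,\phi(\lceil t_1\rceil)\bigr),$$ where the first minimum is attained, $\phi(x)=\dfrac{x}{(x-1)^{\alpha-1}}$ for $x\ge2$, and $t_1=\dfrac1{2-\alpha}$. **(f)** If $1<\alpha<2$ and $\mathrm{supp}(\nu_1)=\mathrm{supp}(\nu_2)=\{-1\}$, then $c=a$. -/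

import Mathlib

namespace TopEigenvalue

noncomputable section

/-- The unit circle of the complex plane, with its Borel σ-algebra as a subspace of `ℂ`. -/
abbrev UnitCircle : Type := Metric.sphere (0 : ℂ) 1

/-- `z` is zero, or its angle `z / |z|` belongs to the support of `ν`. -/
def AngleIn (ν : MeasureTheory.Measure UnitCircle) (z : ℂ) : Prop :=
  z = 0 ∨ ∃ u ∈ ν.support, (u : ℂ) = z / (‖z‖ : ℂ)

/-- The Hermitian matrices of size `n` whose nonzero diagonal entries have their angle in
`supp ν₁`, and whose nonzero entries above the diagonal have their angle in `supp ν₂`. -/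
def domain (ν₁ ν₂ : MeasureTheory.Measure UnitCircle) (n : ℕ) :
    Set (Matrix (Fin n) (Fin n) ℂ) :=
  {A | A.IsHermitian ∧ (∀ i, AngleIn ν₁ (A i i)) ∧ ∀ i j, i < j → AngleIn ν₂ (A i j)}

/-- The largest (real) eigenvalue; used for Hermitian matrices of size `n ≥ 1`. -/
def largestEigenvalue {n : ℕ} (A : Matrix (Fin n) (Fin n) ℂ) : ℝ :=
  sSup (spectrum ℝ A)

/-- `I(A) = b ∑ᵢ |Aᵢᵢ|^α + a ∑_{i<j} |Aᵢⱼ|^α`. -/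
def cost (α a b : ℝ) {n : ℕ} (A : Matrix (Fin n) (Fin n) ℂ) : ℝ :=
  b * ∑ i, ‖A i i‖ ^ α + a * ∑ i, ∑ j ∈ Finset.Ioi i, ‖A i j‖ ^ α

/-- The matrices of size `n` in the domain whose largest eigenvalue is one. -/
def feasible (ν₁ ν₂ : MeasureTheory.Measure UnitCircle) (n : ℕ) :
    Set (Matrix (Fin n) (Fin n) ℂ) :=
  {A | A ∈ domain ν₁ ν₂ n ∧ largestEigenvalue A = 1}

/-- The constant `c`: the infimum of the cost over the feasible matrices of all sizes `n ≥ 1`. -/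
def rateConst (α a b : ℝ) (ν₁ ν₂ : MeasureTheory.Measure UnitCircle) : ℝ :=
  sInf {r | ∃ n : ℕ, 1 ≤ n ∧ ∃ A ∈ feasible ν₁ ν₂ n, r = cost α a b A}

/-- The `n × n` matrix with `s` on the diagonal and `t` off the diagonal, divided by
`s + (n - 1) t`. -/
def B (n : ℕ) (s t : ℝ) : Matrix (Fin n) (Fin n) ℂ :=
  Matrix.of fun i j => (((if i = j then s else t) / (s + ((n : ℝ) - 1) * t) : ℝ) : ℂ)

/-- `ψ(t) = t / ((1/b)^{1/(α-1)} + (t-1) (2/a)^{1/(α-1)})^{α-1}`, for `t ≥ 1`. -/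
def psi (α a b t : ℝ) : ℝ :=
  t / ((1 / b) ^ (1 / (α - 1)) + (t - 1) * (2 / a) ^ (1 / (α - 1))) ^ (α - 1)

/-- `t₀ = (1 - (a/(2b))^{1/(α-1)}) / (2 - α)`. -/
def tZero (α a b : ℝ) : ℝ :=
  1 / (2 - α) * (1 - (a / (2 * b)) ^ (1 / (α - 1)))

/-- `φ(t) = t / (t-1)^{α-1}`, for `t ≥ 2`. -/
def phi (α t : ℝ) : ℝ := t / (t - 1) ^ (α - 1)

/-- `t₁ = 1 / (2 - α)`. -/
def tOne (α : ℝ) : ℝ := 1 / (2 - α)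

end

end TopEigenvalue

/-! ### Maximizers on the simplex are uniform -/

namespace TopEigenvalue

open Finset

/-! Let `v` be a unit eigenvector of a feasible matrix for the eigenvalue 1. Then 1 is the sum of
the real parts of `conj(vᵢ) Aᵢⱼ vⱼ`, hence at most `∑ |Aᵢⱼ| |vᵢ| |vⱼ|`. As a full double sum, the
cost has weight `b` on the diagonal and `a/2` off it. For `α > 1`, weighted Hölder
(`one_le_cost_mul`) gives `1 ≤ I(A) · Q ^ (α - 1)`. Here `Q` is a quadratic form in the `pᵢ ^ γ`,
with `pᵢ = |vᵢ|²` a point of the simplex, `γ = α / (2(α - 1))`, and coefficients `s =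
(1/b)^(1/(α-1))` on the diagonal and `t = (2/a)^(1/(α-1))` off it.

Since `α < 2`, one has `γ > 1`. If `s < t`, a maximizer of `Q` on the simplex has all its nonzero
coordinates equal (`exists_uniform_ge`): moving two unequal positive coordinates either to their
mean or to the boundary increases `Q`. With `k` equal coordinates the bound is `I(A) ≥ k / (s +
(k-1)t)^(α-1)`, the `profile`. Equality in Hölder dictates the matrix `B k s t`, whose cost is
exactly this. The profile decreases and then increases, so only the integers around its turning
point matter. If `t ≤ s`, then `Q ≤ s` at once.

Missing angles delete terms. When 1 is not an angle on the diagonal, the real diagonal entries are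
nonpositive, so `s` becomes 0 and `k = 1` is excluded. When -1 is the only angle off the diagonal,
the eigenvector can be taken real and only pairs of opposite signs help. Merging the coordinates of
each sign leaves a two-point simplex, so `k ≤ 2` (`exists_le_two_sign_sum_le`).

For `α ≤ 1` no optimization is needed: `x ≤ x ^ α` on `[0, 1]` gives a termwise comparison. -/

theorem strictMonoOn_rpow_neg_add {d k : ℝ} (hk : 0 < k) :
    StrictMonoOn (fun r : ℝ => (d - r) ^ (-k) + (d + r) ^ (-k)) (Set.Ioo 0 d) := by
  have hder : ∀ r ∈ Set.Ioo 0 d, HasDerivAt (fun r : ℝ => (d - r) ^ (-k) + (d + r) ^ (-k))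
      (k * ((d - r) ^ (-k - 1) - (d + r) ^ (-k - 1))) r := by
    intro r hr
    have h1 : HasDerivAt (fun r : ℝ => (d - r) ^ (-k)) _ r :=
      ((hasDerivAt_id' r).const_sub d).rpow_const (Or.inl (by linarith [hr.2]))
    have h2 : HasDerivAt (fun r : ℝ => (d + r) ^ (-k)) _ r :=
      ((hasDerivAt_id' r).const_add d).rpow_const (Or.inl (by linarith [hr.1, hr.2]))
    convert! h1.add h2 using 1
    ring
  refine strictMonoOn_of_deriv_pos (convex_Ioo 0 d)
    (fun r hr => (hder r hr).continuousAt.continuousWithinAt) fun r hr => ?_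
  rw [interior_Ioo] at hr
  rw [(hder r hr).deriv]
  have : (d + r) ^ (-k - 1) < (d - r) ^ (-k - 1) :=
    Real.rpow_lt_rpow_of_neg (by linarith [hr.2]) (by linarith [hr.1]) (by linarith)
  exact mul_pos hk (by linarith)

/-- The numerator is strictly convex in `r` and vanishes at 0, so the quotient is the slope of a
secant through the origin. -/
theorem rpow_neg_sub_div_lt {d e r₁ r₂ : ℝ} (he : 0 < e) (h1 : 0 < r₁) (h12 : r₁ < r₂)
    (h2 : r₂ < d) :
    ((d - r₁) ^ (-e) - (d + r₁) ^ (-e)) / r₁ < ((d - r₂) ^ (-e) - (d + r₂) ^ (-e)) / r₂ := by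
  set g : ℝ → ℝ := fun r => (d - r) ^ (-e) - (d + r) ^ (-e) with hg
  have hder : ∀ r ∈ Set.Ico 0 d, HasDerivAt g
      (e * ((d - r) ^ (-(e + 1)) + (d + r) ^ (-(e + 1)))) r := by
    intro r hr
    have h1 : HasDerivAt (fun r : ℝ => (d - r) ^ (-e)) _ r :=
      ((hasDerivAt_id' r).const_sub d).rpow_const (Or.inl (by linarith [hr.2]))
    have h2 : HasDerivAt (fun r : ℝ => (d + r) ^ (-e)) _ r :=
      ((hasDerivAt_id' r).const_add d).rpow_const (Or.inl (by linarith [hr.1, hr.2]))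
    convert! h1.sub h2 using 1
    rw [show -(e + 1) = -e - 1 by ring]
    ring
  have hconv : StrictConvexOn ℝ (Set.Ico 0 d) g := by
    refine StrictMonoOn.strictConvexOn_of_deriv (convex_Ico 0 d)
      (fun r hr => (hder r hr).continuousAt.continuousWithinAt) ?_
    rw [interior_Ico]
    intro x hx y hy hxy
    rw [(hder x ⟨hx.1.le, hx.2⟩).deriv, (hder y ⟨hy.1.le, hy.2⟩).deriv]
    exact mul_lt_mul_of_pos_left (strictMonoOn_rpow_neg_add (by linarith) hx hy hxy) he
  have := hconv.secant_strict_mono (a := 0) (x := r₁) (y := r₂) ⟨le_rfl, by linarith⟩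
    ⟨h1.le, by linarith⟩ ⟨by linarith, h2⟩ h1.ne' (by linarith) h12
  simpa [hg] using this

/-- The part of the objective that depends on two coordinates `d + r` and `d - r`, when the
`γ`-th powers of the other coordinates add up to `R`. -/
noncomputable def pairObjective (s t γ R d r : ℝ) : ℝ :=
  s * ((d + r) ^ γ + (d - r) ^ γ) ^ 2 + 2 * (t - s) * ((d + r) ^ γ * (d - r) ^ γ)
    + 2 * t * R * ((d + r) ^ γ + (d - r) ^ γ)

theorem continuous_pairObjective {s t γ R d : ℝ} (hγ : 1 < γ) :
    Continuous (pairObjective s t γ R d) := by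
  have h1 : Continuous fun r : ℝ => (d + r) ^ γ :=
    (continuous_const.add continuous_id).rpow_const fun _ => Or.inr (by linarith)
  have h2 : Continuous fun r : ℝ => (d - r) ^ γ :=
    (continuous_const.sub continuous_id).rpow_const fun _ => Or.inr (by linarith)
  unfold pairObjective
  fun_prop

/-- Factored so that the sign of the derivative is that of the last bracket, an increasing quotient
times a nondecreasing factor, minus a constant. -/
theorem hasDerivAt_pairObjective {s t γ R d r : ℝ} (hr0 : 0 < r) (hrd : r < d) :
    HasDerivAt (pairObjective s t γ R d)
      (2 * γ * ((d + r) ^ (γ - 1) * (d - r) ^ (γ - 1)) * r *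
        (((d - r) ^ (-(γ - 1)) - (d + r) ^ (-(γ - 1))) / r *
          (s * ((d + r) ^ γ + (d - r) ^ γ) + t * R) - 2 * (t - s))) r := by
  have hp : 0 < d + r := by linarith
  have hm : 0 < d - r := by linarith
  have h1 : HasDerivAt (fun r : ℝ => (d + r) ^ γ) _ r :=
    ((hasDerivAt_id' r).const_add d).rpow_const (Or.inl hp.ne')
  have h2 : HasDerivAt (fun r : ℝ => (d - r) ^ γ) _ r :=
    ((hasDerivAt_id' r).const_sub d).rpow_const (Or.inl hm.ne')
  have h3 := ((((h1.add h2).pow 2).const_mul s).add ((h1.mul h2).const_mul (2 * (t - s)))).add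
    ((h1.add h2).const_mul (2 * t * R))
  convert! h3 using 1
  have e1 : (d + r) ^ γ = (d + r) ^ (γ - 1) * (d + r) := by
    rw [← Real.rpow_add_one hp.ne']; ring_nf
  have e2 : (d - r) ^ γ = (d - r) ^ (γ - 1) * (d - r) := by
    rw [← Real.rpow_add_one hm.ne']; ring_nf
  have p1 : 0 < (d + r) ^ (γ - 1) := Real.rpow_pos_of_pos hp _
  have p2 : 0 < (d - r) ^ (γ - 1) := Real.rpow_pos_of_pos hm _
  rw [Real.rpow_neg hp.le, Real.rpow_neg hm.le]
  simp only [Pi.add_apply, e1, e2]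
  field_simp
  ring

/-- Once the bracket in the derivative is nonnegative it is positive from there on, so the objective
has no interior maximum. Its sign at `r` decides which endpoint wins. -/
theorem pairObjective_lt_max {s t γ R d r : ℝ} (hs : 0 ≤ s) (hst : s < t) (hγ : 1 < γ)
    (hR : 0 ≤ R) (hr0 : 0 < r) (hrd : r < d) :
    pairObjective s t γ R d r <
      max (pairObjective s t γ R d 0) (pairObjective s t γ R d d) := by
  have ht : 0 < t := by linarith
  set g : ℝ → ℝ := fun r => ((d - r) ^ (-(γ - 1)) - (d + r) ^ (-(γ - 1))) / r with hg
  set K : ℝ → ℝ := fun r => (d + r) ^ γ + (d - r) ^ γ with hK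
  have hKpos : ∀ x ∈ Set.Icc 0 d, 0 ≤ K x := fun x hx =>
    add_nonneg (Real.rpow_nonneg (by linarith [hx.1, hx.2]) _)
      (Real.rpow_nonneg (by linarith [hx.2]) _)
  have hKmono : MonotoneOn K (Set.Icc 0 d) := by
    have hder : ∀ x, HasDerivAt K (γ * ((d + x) ^ (γ - 1) - (d - x) ^ (γ - 1))) x := by
      intro x
      have h1 : HasDerivAt (fun r : ℝ => (d + r) ^ γ) _ x :=
        ((hasDerivAt_id' x).const_add d).rpow_const (Or.inr hγ.le)
      have h2 : HasDerivAt (fun r : ℝ => (d - r) ^ γ) _ x :=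
        ((hasDerivAt_id' x).const_sub d).rpow_const (Or.inr hγ.le)
      convert! h1.add h2 using 1
      ring
    refine monotoneOn_of_deriv_nonneg (convex_Icc 0 d)
      (fun x _ => (hder x).continuousAt.continuousWithinAt)
      (fun x _ => (hder x).differentiableAt.differentiableWithinAt) fun x hx => ?_
    rw [interior_Icc] at hx
    rw [(hder x).deriv]
    have : (d - x) ^ (γ - 1) ≤ (d + x) ^ (γ - 1) :=
      Real.rpow_le_rpow (by linarith [hx.2]) (by linarith [hx.1]) (by linarith)
    exact mul_nonneg (by linarith) (by linarith)
  have hgpos : ∀ x, 0 < x → x < d → 0 < g x := by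
    intro x hx hxd
    have : (d + x) ^ (-(γ - 1)) < (d - x) ^ (-(γ - 1)) :=
      Real.rpow_lt_rpow_of_neg (by linarith) (by linarith) (by linarith)
    exact div_pos (by linarith) hx
  have hglt : ∀ x y, 0 < x → x < y → y < d → g x < g y := fun x y hx hxy hy =>
    rpow_neg_sub_div_lt (by linarith) hx hxy hy
  have hLpos : ∀ x ∈ Set.Icc 0 d, 0 ≤ s * K x + t * R := fun x hx =>
    add_nonneg (mul_nonneg hs (hKpos x hx)) (mul_nonneg ht.le hR)
  have hLmono : ∀ x y, 0 ≤ x → x ≤ y → y ≤ d → s * K x + t * R ≤ s * K y + t * R :=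
    fun x y hx hxy hy => by
      have := hKmono ⟨hx, by linarith⟩ ⟨by linarith, hy⟩ hxy
      have := mul_le_mul_of_nonneg_left this hs
      linarith
  have hfac : ∀ x, 0 < x → x < d → 0 < 2 * γ * ((d + x) ^ (γ - 1) * (d - x) ^ (γ - 1)) * x :=
    fun x hx hxd => by
      have p1 : 0 < (d + x) ^ (γ - 1) := Real.rpow_pos_of_pos (by linarith) _
      have p2 : 0 < (d - x) ^ (γ - 1) := Real.rpow_pos_of_pos (by linarith) _
      positivity
  rw [lt_max_iff]
  by_cases hJ : 0 ≤ g r * (s * K r + t * R) - 2 * (t - s)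
  · right
    refine strictMonoOn_of_deriv_pos (convex_Icc r d)
      (continuous_pairObjective hγ).continuousOn (fun x hx => ?_)
      (Set.left_mem_Icc.2 hrd.le) (Set.right_mem_Icc.2 hrd.le) hrd
    rw [interior_Icc] at hx
    have hx0 : 0 < x := hr0.trans hx.1
    rw [(hasDerivAt_pairObjective hx0 hx.2).deriv]
    refine mul_pos (hfac x hx0 hx.2) ?_
    -- If this factor vanished, `hJ` would say `0 ≤ -2 (t - s)`, against `s < t`.
    have hL : 0 < s * K r + t * R := by
      rcases (hLpos r ⟨hr0.le, hrd.le⟩).lt_or_eq with h | h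
      · exact h
      · rw [← h] at hJ; linarith
    have h1 := hLmono r x hr0.le hx.1.le hx.2.le
    have h2 := hglt r x hr0 hx.1 hx.2
    have h3 : g r * (s * K r + t * R) < g x * (s * K x + t * R) :=
      mul_lt_mul h2 h1 hL (hgpos x hx0 hx.2).le
    show 0 < g x * (s * K x + t * R) - 2 * (t - s)
    linarith
  · left
    push Not at hJ
    refine strictAntiOn_of_deriv_neg (convex_Icc 0 r)
      (continuous_pairObjective hγ).continuousOn (fun x hx => ?_)
      (Set.left_mem_Icc.2 hr0.le) (Set.right_mem_Icc.2 hr0.le) hr0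
    rw [interior_Icc] at hx
    have hxd : x < d := hx.2.trans hrd
    rw [(hasDerivAt_pairObjective hx.1 hxd).deriv]
    refine mul_neg_of_pos_of_neg (hfac x hx.1 hxd) ?_
    have h1 := hLmono x r hx.1.le hx.2.le hrd.le
    have h2 := hglt x r hx.1 hx.2 hrd
    have h3 : g x * (s * K x + t * R) ≤ g r * (s * K r + t * R) :=
      mul_le_mul h2.le h1 (hLpos x ⟨hx.1.le, hxd.le⟩) (hgpos r hr0 hrd).le
    show g x * (s * K x + t * R) - 2 * (t - s) < 0
    linarith

/-- Sum of `y` with two distinct terms separated. -/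
theorem sum_eq_pair_add {ι : Type*} [Fintype ι] [DecidableEq ι] {i j : ι} (hij : i ≠ j)
    (y : ι → ℝ) : ∑ k, y k = y i + y j + ∑ k ∈ (univ.erase i).erase j, y k := by
  rw [← add_sum_erase univ y (mem_univ i),
    ← add_sum_erase (univ.erase i) y (mem_erase.2 ⟨hij.symm, mem_univ j⟩)]
  ring

/-- On the simplex, `t (∑ pᵢ^γ)² - (t - s) ∑ pᵢ^(2γ)` is at most its value at the uniform
distribution on some number `k` of points. -/
theorem exists_uniform_ge {ι : Type*} [Fintype ι] [Nonempty ι] {s t γ : ℝ} (hs : 0 ≤ s)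
    (hst : s < t) (hγ : 1 < γ) {p : ι → ℝ} (hp : p ∈ stdSimplex ℝ ι) :
    ∃ k : ℕ, 1 ≤ k ∧ k ≤ Fintype.card ι ∧ t * (∑ i, p i ^ γ) ^ 2 - (t - s) * ∑ i, (p i ^ γ) ^ 2 ≤
      (k : ℝ) ^ (1 - 2 * γ) * (s + (k - 1) * t) := by
  classical
  set F : (ι → ℝ) → ℝ := fun p => t * (∑ i, p i ^ γ) ^ 2 - (t - s) * ∑ i, (p i ^ γ) ^ 2 with hF
  have hcont : Continuous F := by
    have : ∀ i, Continuous fun p : ι → ℝ => p i ^ γ := fun i =>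
      (continuous_apply i).rpow_const fun _ => Or.inr (by linarith)
    fun_prop
  obtain ⟨q, hq, hmax⟩ := (isCompact_stdSimplex ℝ ι).exists_isMaxOn ⟨p, hp⟩ hcont.continuousOn
  have hle : F p ≤ F q := hmax hp
  -- Two unequal positive coordinates are `d + r` and `d - r` with `0 < r < d`. Keeping their sum
  -- fixed, `x = 0` averages them and `x = d` merges them into one; one of the two moves would beat
  -- the maximum.
  have key : ∀ i j, 0 < q j → ¬ q j < q i := by
    intro i j hj hlt
    have hij : i ≠ j := fun h => by simp [h] at hlt
    set d := (q i + q j) / 2 with hd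
    set r := (q i - q j) / 2 with hr
    set R := ∑ k ∈ (univ.erase i).erase j, q k ^ γ with hRdef
    set R2 := ∑ k ∈ (univ.erase i).erase j, (q k ^ γ) ^ 2 with hR2def
    have hR : 0 ≤ R := sum_nonneg fun k _ => Real.rpow_nonneg (hq.1 k) _
    let q' : ℝ → ι → ℝ := fun x => Function.update (Function.update q i (d + x)) j (d - x)
    have hqi : ∀ x, q' x i = d + x := fun x => by simp [q', hij]
    have hqj : ∀ x, q' x j = d - x := fun x => by simp [q']
    have hqk : ∀ x, ∀ k ∈ (univ.erase i).erase j, q' x k = q k := fun x k hk => by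
      simp only [mem_erase, mem_univ, and_true] at hk
      simp [q', hk.1, hk.2]
    have hqr : q' r = q := by
      funext k
      by_cases hkj : k = j
      · subst hkj; rw [hqj]; simp only [hd, hr]; ring
      by_cases hki : k = i
      · subst hki; rw [hqi]; simp only [hd, hr]; ring
      exact hqk r k (by simp [hkj, hki])
    have hFx : ∀ x, F (q' x) = pairObjective s t γ R d x + (t * R ^ 2 - (t - s) * R2) := by
      intro x
      simp only [hF]
      have h1 : ∑ k ∈ (univ.erase i).erase j, q' x k ^ γ = R :=
        sum_congr rfl fun k hk => by rw [hqk x k hk]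
      have h2 : ∑ k ∈ (univ.erase i).erase j, (q' x k ^ γ) ^ 2 = R2 :=
        sum_congr rfl fun k hk => by rw [hqk x k hk]
      rw [sum_eq_pair_add hij, sum_eq_pair_add hij (fun k => (q' x k ^ γ) ^ 2), h1, h2, hqi, hqj,
        pairObjective]
      ring
    have hmem : ∀ x, 0 ≤ x → x ≤ d → q' x ∈ stdSimplex ℝ ι := by
      intro x h0 hx
      refine ⟨fun k => ?_, ?_⟩
      · by_cases hkj : k = j
        · subst hkj; rw [hqj]; linarith
        by_cases hki : k = i
        · subst hki; rw [hqi]; linarith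
        rw [hqk x k (by simp [hkj, hki])]; exact hq.1 k
      · have h1 := hq.2
        rw [sum_eq_pair_add hij] at h1 ⊢
        rw [hqi, hqj, sum_congr rfl (hqk x), ← h1]
        simp only [hd]; ring
    have hr0 : 0 < r := by simp only [hr]; linarith
    have hrd : r < d := by simp only [hr, hd]; linarith
    have h1 := pairObjective_lt_max (R := R) hs hst hγ hR hr0 hrd
    have h2 : F (q' 0) ≤ F q := hmax (hmem 0 le_rfl (by linarith))
    have h3 : F (q' d) ≤ F q := hmax (hmem d (by linarith) le_rfl)
    rw [← hqr] at h2 h3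
    rw [hFx, hFx] at h2 h3
    rw [lt_max_iff] at h1
    rcases h1 with h1 | h1 <;> linarith
  set S := univ.filter fun i => 0 < q i with hS
  have hzero : ∀ i, i ∉ S → q i = 0 := fun i hi => by
    simp only [hS, mem_filter, mem_univ, true_and, not_lt] at hi
    exact le_antisymm hi (hq.1 i)
  have hne : S.Nonempty := by
    by_contra h
    have h0 : ∀ i, q i = 0 := fun i => hzero i (by simp [not_nonempty_iff_eq_empty.1 h])
    have := hq.2
    simp [h0] at this
  obtain ⟨i₀, hi₀⟩ := hne
  have hk1 : 1 ≤ S.card := card_pos.2 ⟨i₀, hi₀⟩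
  have heq : ∀ i ∈ S, q i = q i₀ := fun i hi =>
    le_antisymm (not_lt.1 (key i i₀ (mem_filter.1 hi₀).2)) (not_lt.1 (key i₀ i (mem_filter.1 hi).2))
  have hsum : ∀ f : ℝ → ℝ, f 0 = 0 → ∑ i, f (q i) = S.card * f (q i₀) := by
    intro f hf
    rw [← sum_subset (subset_univ S) fun i _ hi => by rw [hzero i hi, hf],
      sum_congr rfl fun i hi => by rw [heq i hi], sum_const, nsmul_eq_mul]
  have hkpos : (0 : ℝ) < S.card := by exact_mod_cast hk1
  have hval : q i₀ = (S.card : ℝ)⁻¹ := by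
    have := hsum id rfl
    simp only [id, hq.2] at this
    field_simp
    linarith
  refine ⟨S.card, hk1, card_le_univ S, hle.trans (le_of_eq ?_)⟩
  have hγ0 : γ ≠ 0 := by linarith
  simp only [hF]
  rw [hsum (fun x => x ^ γ) (Real.zero_rpow hγ0),
    hsum (fun x => (x ^ γ) ^ 2) (by simp [Real.zero_rpow hγ0]), hval, Real.inv_rpow hkpos.le,
    show 1 - 2 * γ = 1 - γ - γ by ring, Real.rpow_sub hkpos, Real.rpow_sub hkpos, Real.rpow_one]
  have : 0 < (S.card : ℝ) ^ γ := Real.rpow_pos_of_pos hkpos _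
  field_simp
  ring

end TopEigenvalue

/-! ### Hölder bound, eigenvectors and angles -/

namespace TopEigenvalue

open Finset Matrix

theorem sum_sum_eq_diag_add_Ioi {n : ℕ} (f : Fin n → Fin n → ℝ) (hf : ∀ i j, f i j = f j i) :
    ∑ i, ∑ j, f i j = ∑ i, f i i + 2 * ∑ i, ∑ j ∈ Ioi i, f i j := by
  have h1 : ∀ i, ∑ j, f i j = f i i + ∑ j ∈ Ioi i, f i j + ∑ j ∈ Iio i, f i j := by
    intro i
    rw [← add_sum_erase univ _ (mem_univ i), add_assoc,
      ← sum_union (disjoint_left.2 fun j h1 h2 => by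
        rw [mem_Ioi] at h1; rw [mem_Iio] at h2; exact lt_asymm h1 h2)]
    congr 2
    ext j
    simp [lt_or_lt_iff_ne, eq_comm]
  have h2 : ∑ i, ∑ j ∈ Iio i, f i j = ∑ i, ∑ j ∈ Ioi i, f i j := by
    rw [sum_comm' (t' := univ) (s' := fun j => Ioi j) (by simp)]
    exact sum_congr rfl fun i _ => sum_congr rfl fun j _ => hf _ _
  rw [sum_congr rfl fun i _ => h1 i, sum_add_distrib, sum_add_distrib, h2]
  ring

theorem _root_.Matrix.IsHermitian.norm_apply_comm {n : ℕ} {A : Matrix (Fin n) (Fin n) ℂ}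
    (hA : A.IsHermitian) (i j : Fin n) : ‖A i j‖ = ‖A j i‖ := by
  rw [← hA.apply i j, norm_star]

/-- Each off-diagonal pair is counted twice in the full sum; this is the origin of `a / 2`, and of
`2 / a` after Hölder. -/
theorem cost_eq_sum {n : ℕ} {A : Matrix (Fin n) (Fin n) ℂ} (hA : A.IsHermitian) (α a b : ℝ) :
    cost α a b A = ∑ i, ∑ j, (if i = j then b else a / 2) * ‖A i j‖ ^ α := by
  rw [sum_sum_eq_diag_add_Ioi _ fun i j => by rw [hA.norm_apply_comm i j]; simp only [eq_comm],
    cost, mul_sum, mul_sum, mul_sum]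
  congr 1
  · simp
  · refine sum_congr rfl fun i _ => ?_
    rw [mul_sum, mul_sum]
    refine sum_congr rfl fun j hj => ?_
    rw [if_neg (mem_Ioi.1 hj).ne]
    ring

/-- Hölder's inequality with weights, in the form used to bound the cost from below. -/
theorem one_le_sum_mul_rpow {ι : Type*} {S : Finset ι} {w x z : ι → ℝ} {α : ℝ} (hα : 1 < α)
    (hw : ∀ i, 0 < w i) (hx : ∀ i, 0 ≤ x i) (hz : ∀ i, 0 ≤ z i) (h : 1 ≤ ∑ i ∈ S, x i * z i) :
    1 ≤ (∑ i ∈ S, w i * x i ^ α) *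
      (∑ i ∈ S, (1 / w i) ^ (1 / (α - 1)) * z i ^ (α / (α - 1))) ^ (α - 1) := by
  have hα0 : 0 < α := by linarith
  have hα1 : 0 < α - 1 := by linarith
  have hpq : α.HolderConjugate (α / (α - 1)) := Real.HolderConjugate.conjExponent hα
  have key := Real.inner_le_Lp_mul_Lq_of_nonneg (s := S) hpq
    -- The weights cancel in the product, while the `α`-th power of the first factor is the weighted
    -- cost term.
    (f := fun i => w i ^ (1 / α) * x i) (g := fun i => (1 / w i) ^ (1 / α) * z i)
    (fun i _ => mul_nonneg (Real.rpow_nonneg (hw i).le _) (hx i))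
    (fun i _ => mul_nonneg (Real.rpow_nonneg (one_div_pos.2 (hw i)).le _) (hz i))
  have e0 : ∀ i, w i ^ (1 / α) * x i * ((1 / w i) ^ (1 / α) * z i) = x i * z i := by
    intro i
    rw [show w i ^ (1 / α) * x i * ((1 / w i) ^ (1 / α) * z i)
      = w i ^ (1 / α) * (1 / w i) ^ (1 / α) * (x i * z i) by ring,
      ← Real.mul_rpow (hw i).le (one_div_pos.2 (hw i)).le, mul_one_div_cancel (hw i).ne',
      Real.one_rpow, one_mul]
  have e1 : ∀ i, (w i ^ (1 / α) * x i) ^ α = w i * x i ^ α := by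
    intro i
    rw [Real.mul_rpow (Real.rpow_nonneg (hw i).le _) (hx i), ← Real.rpow_mul (hw i).le,
      one_div_mul_cancel hα0.ne', Real.rpow_one]
  have e2 : ∀ i, ((1 / w i) ^ (1 / α) * z i) ^ (α / (α - 1)) =
      (1 / w i) ^ (1 / (α - 1)) * z i ^ (α / (α - 1)) := by
    intro i
    rw [Real.mul_rpow (Real.rpow_nonneg (one_div_pos.2 (hw i)).le _) (hz i),
      ← Real.rpow_mul (one_div_pos.2 (hw i)).le]
    congr 2
    field_simp
  simp only [e0, e1, e2] at key
  set X := ∑ i ∈ S, w i * x i ^ α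
  set Y := ∑ i ∈ S, (1 / w i) ^ (1 / (α - 1)) * z i ^ (α / (α - 1))
  have hX : 0 ≤ X := sum_nonneg fun i _ => mul_nonneg (hw i).le (Real.rpow_nonneg (hx i) _)
  have hY : 0 ≤ Y := sum_nonneg fun i _ => mul_nonneg
    (Real.rpow_nonneg (one_div_pos.2 (hw i)).le _) (Real.rpow_nonneg (hz i) _)
  -- Raising to the power `α` leaves the cost with exponent 1 and gives the dual sum the exponent `α
  -- / (α / (α - 1)) = α - 1`.
  have h3 := Real.rpow_le_rpow zero_le_one (h.trans key) hα0.le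
  rw [Real.one_rpow, Real.mul_rpow (Real.rpow_nonneg hX _) (Real.rpow_nonneg hY _),
    ← Real.rpow_mul hX, ← Real.rpow_mul hY, one_div_mul_cancel hα0.ne', Real.rpow_one] at h3
  convert! h3 using 3
  field_simp

theorem one_eq_sum_re {n : ℕ} {A : Matrix (Fin n) (Fin n) ℂ} {v : Fin n → ℂ} (hv : A *ᵥ v = v)
    (hv1 : ∑ i, ‖v i‖ ^ 2 = 1) : 1 = ∑ i, ∑ j, (star (v i) * A i j * v j).re := by
  have h1 : ∀ i, ∑ j, (star (v i) * A i j * v j).re = ‖v i‖ ^ 2 := by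
    intro i
    have h2 : ∑ j, star (v i) * A i j * v j = star (v i) * v i := by
      have h3 : v i = ∑ j, A i j * v j := (congrFun hv i).symm
      calc _ = star (v i) * ∑ j, A i j * v j := by simp only [mul_sum, mul_assoc]
        _ = _ := by rw [← h3]
    rw [← Complex.re_sum, h2, ← Complex.normSq_eq_norm_sq, Complex.star_def,
      ← Complex.normSq_eq_conj_mul_self, Complex.ofReal_re]
  rw [sum_congr rfl fun i _ => h1 i, hv1]

theorem re_star_mul_le {n : ℕ} (A : Matrix (Fin n) (Fin n) ℂ) (v : Fin n → ℂ) (i j : Fin n) :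
    (star (v i) * A i j * v j).re ≤ ‖A i j‖ * (‖v i‖ * ‖v j‖) := by
  refine (Complex.re_le_norm _).trans (le_of_eq ?_)
  rw [norm_mul, norm_mul, norm_star]
  ring

/-- Lower bound for the cost of a matrix with a unit eigenvector `v` for the eigenvalue `1`, where
only the pairs in `c` contribute to the quadratic form. -/
theorem one_le_cost_mul {n : ℕ} {A : Matrix (Fin n) (Fin n) ℂ} {α a b : ℝ} (hα : 1 < α)
    (ha : 0 < a) (hb : 0 < b) (hA : A.IsHermitian) {v : Fin n → ℂ} (hv : A *ᵥ v = v)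
    (hv1 : ∑ i, ‖v i‖ ^ 2 = 1) (c : Fin n → Fin n → Prop) [∀ i j, Decidable (c i j)]
    (hc : ∀ i j, ¬ c i j → (star (v i) * A i j * v j).re ≤ 0) :
    1 ≤ cost α a b A * (∑ i, ∑ j, if c i j then
      (if i = j then (1 / b) ^ (1 / (α - 1)) else (2 / a) ^ (1 / (α - 1))) *
        ((‖v i‖ ^ 2) ^ (α / (α - 1) / 2) * (‖v j‖ ^ 2) ^ (α / (α - 1) / 2)) else 0) ^ (α - 1) := by
  have hα1 : 0 < α - 1 := by linarith
  -- Pairs outside `c` contribute nonpositively, so their dual variable is set to 0 before Hölder is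
  -- applied.
  have h1 : 1 ≤ ∑ ij : Fin n × Fin n,
      ‖A ij.1 ij.2‖ * (if c ij.1 ij.2 then ‖v ij.1‖ * ‖v ij.2‖ else 0) := by
    rw [Fintype.sum_prod_type]
    refine (one_eq_sum_re hv hv1).le.trans (sum_le_sum fun i _ => sum_le_sum fun j _ => ?_)
    split_ifs with h
    · exact re_star_mul_le A v i j
    · simpa using hc i j h
  have h2 := one_le_sum_mul_rpow (w := fun ij : Fin n × Fin n => if ij.1 = ij.2 then b else a / 2)
    hα (fun ij => by split_ifs <;> positivity) (fun ij => norm_nonneg _)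
    (fun ij => by split_ifs <;> positivity) h1
  rw [Fintype.sum_prod_type, Fintype.sum_prod_type] at h2
  rw [cost_eq_sum hA]
  convert! h2 using 3
  refine sum_congr rfl fun i _ => sum_congr rfl fun j _ => ?_
  have hpow : ∀ x : ℝ, 0 ≤ x → (x ^ 2) ^ (α / (α - 1) / 2) = x ^ (α / (α - 1)) := by
    intro x hx
    rw [← Real.rpow_natCast, ← Real.rpow_mul hx]
    congr 1
    push_cast
    ring
  rw [hpow _ (norm_nonneg _), hpow _ (norm_nonneg _)]
  have : α / (α - 1) ≠ 0 := by positivity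
  split_ifs <;> simp [Real.mul_rpow, Real.zero_rpow this]

theorem mem_spectrum_iff {n : ℕ} {A : Matrix (Fin n) (Fin n) ℂ} {r : ℝ} :
    r ∈ spectrum ℝ A ↔ ∃ v : Fin n → ℂ, v ≠ 0 ∧ A *ᵥ v = (r : ℂ) • v := by
  rw [spectrum.mem_iff, isUnit_iff_isUnit_det, isUnit_iff_ne_zero, not_not,
    ← exists_mulVec_eq_zero_iff]
  refine exists_congr fun v => and_congr_right fun _ => ?_
  rw [sub_mulVec, sub_eq_zero, Algebra.algebraMap_eq_smul_one, smul_mulVec, one_mulVec, eq_comm]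
  rfl

theorem exists_eigenvector {n : ℕ} {A : Matrix (Fin n) (Fin n) ℂ} (h : largestEigenvalue A = 1) :
    ∃ v : Fin n → ℂ, v ≠ 0 ∧ A *ᵥ v = v := by
  have hne : (spectrum ℝ A).Nonempty := by
    -- An empty spectrum would give `sSup ∅ = 0 ≠ 1`; this also disposes of size 0.
    by_contra hne
    rw [Set.not_nonempty_iff_eq_empty] at hne
    simp [largestEigenvalue, hne] at h
  have hmem := hne.csSup_mem A.finite_real_spectrum
  rw [show sSup (spectrum ℝ A) = 1 from h, mem_spectrum_iff] at hmem
  simpa using hmem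

theorem exists_unit_eigenvector {n : ℕ} {A : Matrix (Fin n) (Fin n) ℂ}
    (h : largestEigenvalue A = 1) : ∃ v : Fin n → ℂ, A *ᵥ v = v ∧ ∑ i, ‖v i‖ ^ 2 = 1 := by
  obtain ⟨v, hv0, hv⟩ := exists_eigenvector h
  have hpos : 0 < ∑ i, ‖v i‖ ^ 2 := by
    obtain ⟨i, hi⟩ := Function.ne_iff.1 hv0
    exact sum_pos' (fun i _ => by positivity) ⟨i, mem_univ i, pow_pos (norm_pos_iff.2 hi) 2⟩
  refine ⟨((√(∑ i, ‖v i‖ ^ 2))⁻¹ : ℂ) • v, by rw [mulVec_smul, hv], ?_⟩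
  simp only [Pi.smul_apply, smul_eq_mul, norm_mul, mul_pow, ← mul_sum, norm_inv, Complex.norm_real,
    Real.norm_eq_abs, sq_abs, inv_pow, Real.sq_sqrt hpos.le]
  exact inv_mul_cancel₀ hpos.ne'

/-- A real matrix fixes the real and imaginary parts of a fixed vector separately, and one of them
is nonzero. -/
theorem exists_real_unit_eigenvector {n : ℕ} {A : Matrix (Fin n) (Fin n) ℂ}
    (h : largestEigenvalue A = 1) (hA : ∀ i j, (A i j).im = 0) :
    ∃ u : Fin n → ℝ, (A *ᵥ fun i => (u i : ℂ)) = (fun i => (u i : ℂ)) ∧ ∑ i, u i ^ 2 = 1 := by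
  obtain ⟨v, hv0, hv⟩ := exists_eigenvector h
  have hre : (A *ᵥ fun i => ((v i).re : ℂ)) = fun i => ((v i).re : ℂ) := by
    funext i
    have := congrArg Complex.re (congrFun hv i)
    simp only [mulVec, dotProduct, Complex.re_sum, Complex.mul_re, hA, zero_mul, sub_zero] at this
    apply Complex.ext
    · simp [mulVec, dotProduct, hA, this]
    · simp [mulVec, dotProduct, hA]
  have him : (A *ᵥ fun i => ((v i).im : ℂ)) = fun i => ((v i).im : ℂ) := by
    funext i
    have := congrArg Complex.im (congrFun hv i)
    simp only [mulVec, dotProduct, Complex.im_sum, Complex.mul_im, hA, zero_mul, add_zero] at this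
    apply Complex.ext
    · simp [mulVec, dotProduct, hA, this]
    · simp [mulVec, dotProduct, hA]
  obtain ⟨u, hu0, hu⟩ : ∃ u : Fin n → ℝ, u ≠ 0 ∧
      (A *ᵥ fun i => (u i : ℂ)) = fun i => (u i : ℂ) := by
    by_cases h0 : (fun i => (v i).re) = 0
    · refine ⟨fun i => (v i).im, fun h1 => hv0 ?_, him⟩
      funext i
      exact Complex.ext (congrFun h0 i) (congrFun h1 i)
    · exact ⟨_, h0, hre⟩
  have hpos : 0 < ∑ i, u i ^ 2 := by
    obtain ⟨i, hi⟩ := Function.ne_iff.1 hu0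
    exact sum_pos' (fun i _ => sq_nonneg _) ⟨i, mem_univ i, pow_two_pos_of_ne_zero hi⟩
  refine ⟨fun i => (√(∑ i, u i ^ 2))⁻¹ * u i, ?_, ?_⟩
  · have : (fun i => (((√(∑ i, u i ^ 2))⁻¹ * u i : ℝ) : ℂ)) =
        ((√(∑ i, u i ^ 2))⁻¹ : ℂ) • fun i => (u i : ℂ) := by
      funext i; simp
    rw [this, mulVec_smul, hu]
  · simp only [mul_pow, ← mul_sum, inv_pow, Real.sq_sqrt hpos.le]
    exact inv_mul_cancel₀ hpos.ne'

/-- Gershgorin's disc theorem bounds every eigenvalue by an absolute row sum. -/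
theorem largestEigenvalue_eq_one {n : ℕ} {A : Matrix (Fin n) (Fin n) ℂ} {v : Fin n → ℂ}
    (hv0 : v ≠ 0) (hv : A *ᵥ v = v) (hrow : ∀ i, ∑ j, ‖A i j‖ ≤ 1) : largestEigenvalue A = 1 := by
  refine IsGreatest.csSup_eq ⟨mem_spectrum_iff.2 ⟨v, hv0, by simpa using hv⟩, fun r hr => ?_⟩
  obtain ⟨x, hx0, hx⟩ := mem_spectrum_iff.1 hr
  have he : Module.End.HasEigenvalue (toLin' A) (r : ℂ) :=
    Module.End.hasEigenvalue_of_hasEigenvector (x := x)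
      ⟨Module.End.mem_eigenspace_iff.2 (by rw [toLin'_apply, hx]), hx0⟩
  obtain ⟨k, hk⟩ := eigenvalue_mem_ball he
  rw [mem_closedBall_iff_norm] at hk
  have h1 : ‖(r : ℂ)‖ ≤ ‖A k k‖ + ‖(r : ℂ) - A k k‖ := norm_le_norm_add_norm_sub' _ _
  have h2 := hrow k
  rw [← add_sum_erase univ _ (mem_univ k)] at h2
  have h3 : r ≤ ‖(r : ℂ)‖ := by rw [Complex.norm_real]; exact Real.le_norm_self r
  linarith

section Angle

open MeasureTheory

variable {ν : Measure UnitCircle}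

theorem angleIn_zero : AngleIn ν 0 := Or.inl rfl

theorem angleIn_coe (u : UnitCircle) (hu : u ∈ ν.support) : AngleIn ν u :=
  Or.inr ⟨u, hu, by rw [norm_eq_of_mem_sphere]; simp⟩

theorem angleIn_ofReal (h : 1 ∈ ν.support) {x : ℝ} (hx : 0 ≤ x) : AngleIn ν x := by
  rcases hx.eq_or_lt with rfl | hx
  · exact Or.inl rfl
  · refine Or.inr ⟨1, h, ?_⟩
    have : (x : ℂ) ≠ 0 := by exact_mod_cast hx.ne'
    rw [Complex.norm_real, Real.norm_of_nonneg hx.le, div_self this]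
    rfl

theorem angleIn_neg_ofReal (h : -1 ∈ ν.support) {x : ℝ} (hx : 0 ≤ x) :
    AngleIn ν (-(x : ℂ)) := by
  rcases hx.eq_or_lt with rfl | hx
  · exact Or.inl (by simp)
  · refine Or.inr ⟨-1, h, ?_⟩
    have : (x : ℂ) ≠ 0 := by exact_mod_cast hx.ne'
    rw [norm_neg, Complex.norm_real, Real.norm_of_nonneg hx.le, neg_div, div_self this]
    rfl

theorem AngleIn.eq_neg_norm (h : ν.support = {-1}) {z : ℂ} (hz : AngleIn ν z) :
    z = -(‖z‖ : ℂ) := by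
  rcases hz with rfl | ⟨u, hu, huz⟩
  · simp
  · rw [h, Set.mem_singleton_iff] at hu
    by_cases hz0 : z = 0
    · simp [hz0]
    · have : (‖z‖ : ℂ) ≠ 0 := by simpa using hz0
      rw [hu, eq_div_iff this] at huz
      rw [← huz]
      change (-1 : ℂ) * _ = _
      simp

theorem AngleIn.re_nonpos (h : 1 ∉ ν.support) {z : ℂ} (hz : AngleIn ν z) (him : z.im = 0) :
    z.re ≤ 0 := by
  by_contra hpos
  push Not at hpos
  have hzr : z = (z.re : ℂ) := Complex.ext rfl (by simp [him])
  rcases hz with rfl | ⟨u, hu, huz⟩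
  · simp at hpos
  · apply h
    have h0 : (z.re : ℂ) ≠ 0 := by exact_mod_cast hpos.ne'
    have : u = 1 := by
      apply Subtype.ext
      rw [huz, hzr, Complex.norm_real, Real.norm_of_nonneg hpos.le, div_self h0]
      rfl
    rwa [← this]

end Angle

theorem _root_.Matrix.IsHermitian.im_diag {n : ℕ} {A : Matrix (Fin n) (Fin n) ℂ}
    (hA : A.IsHermitian) (i : Fin n) : (A i i).im = 0 :=
  Complex.conj_eq_iff_im.1 (hA.apply i i)

end TopEigenvalue

/-! ### From the Hölder bound to the profile -/

namespace TopEigenvalue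

open Finset Matrix MeasureTheory

theorem cost_nonneg {n : ℕ} {α a b : ℝ} (ha : 0 ≤ a) (hb : 0 ≤ b)
    (A : Matrix (Fin n) (Fin n) ℂ) : 0 ≤ cost α a b A := by
  unfold cost
  positivity

theorem one_div_rpow_le_of_one_le {C Q G ε : ℝ} (hC : 0 ≤ C) (hε : 0 < ε) (hQ : 0 ≤ Q)
    (hQG : Q ≤ G) (hG : 0 < G) (h : 1 ≤ C * Q ^ ε) : 1 / G ^ ε ≤ C := by
  rw [div_le_iff₀ (Real.rpow_pos_of_pos hG _)]
  exact h.trans (mul_le_mul_of_nonneg_left (Real.rpow_le_rpow hQ hQG hε.le) hC)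

theorem sum_sum_quad {ι : Type*} [Fintype ι] [DecidableEq ι] (s t : ℝ) (y : ι → ℝ) :
    ∑ i, ∑ j, (if i = j then s else t) * (y i * y j) =
      t * (∑ i, y i) ^ 2 - (t - s) * ∑ i, y i ^ 2 := by
  have h1 : ∀ i j, (if i = j then s else t) * (y i * y j) =
      t * (y i * y j) - if i = j then (t - s) * (y i * y j) else 0 := by
    intro i j
    split_ifs <;> ring
  simp only [h1, sum_sub_distrib, sum_ite_eq, mem_univ, if_true, ← mul_sum]
  rw [sq, sum_mul_sum]
  simp only [mul_sum, sq]

/-- The cost of the uniform matrix of size `x`, extended to real `x`. -/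
noncomputable def profile (s t ε x : ℝ) : ℝ := x / (s + (x - 1) * t) ^ ε

/-- With `γ = α / (2(α - 1))` one has `(1 - 2γ)(α - 1) = -1`, so the power of `k` becomes the
numerator of the profile. -/
theorem one_div_uniform_rpow {s t α k : ℝ} (hα : 1 < α) (hk : 0 < k) (hD : 0 ≤ s + (k - 1) * t) :
    1 / (k ^ (1 - 2 * (α / (α - 1) / 2)) * (s + (k - 1) * t)) ^ (α - 1) =
      profile s t (α - 1) k := by
  have hα1 : α - 1 ≠ 0 := by linarith
  rw [Real.mul_rpow (Real.rpow_nonneg hk.le _) hD, ← Real.rpow_mul hk.le,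
    show (1 - 2 * (α / (α - 1) / 2)) * (α - 1) = -1 by field_simp; ring, Real.rpow_neg_one,
    profile, one_div, mul_inv, inv_inv, div_eq_mul_inv]

theorem profile_le_of_one_le {s t α Q C : ℝ} {k : ℕ} (hα : 1 < α) (hs : 0 ≤ s) (ht : 0 < t)
    (hC : 0 ≤ C) (hk : 1 ≤ k) (hQ : 0 ≤ Q)
    (hQk : Q ≤ (k : ℝ) ^ (1 - 2 * (α / (α - 1) / 2)) * (s + (k - 1) * t))
    (h : 1 ≤ C * Q ^ (α - 1)) : profile s t (α - 1) k ≤ C := by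
  have hα1 : 0 < α - 1 := by linarith
  have hk1 : (1 : ℝ) ≤ k := by exact_mod_cast hk
  have hQ0 : 0 < Q := by
    rcases hQ.lt_or_eq with h0 | h0
    · exact h0
    · rw [← h0, Real.zero_rpow hα1.ne'] at h
      linarith
  rw [← one_div_uniform_rpow hα (by linarith)
    (add_nonneg hs (mul_nonneg (by linarith) ht.le))]
  exact one_div_rpow_le_of_one_le hC hα1 hQ hQk (hQ0.trans_le hQk) h

/-- This is where `α < 2` enters the simplex problem. -/
theorem one_lt_half_conj {α : ℝ} (hα : 1 < α) (hα2 : α < 2) : 1 < α / (α - 1) / 2 := by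
  have : 0 < α - 1 := by linarith
  rw [div_div, one_lt_div (by positivity)]
  linarith

theorem sq_norm_mem_stdSimplex {n : ℕ} {v : Fin n → ℂ} (hv : ∑ i, ‖v i‖ ^ 2 = 1) :
    (fun i => ‖v i‖ ^ 2) ∈ stdSimplex ℝ (Fin n) := ⟨fun _ => sq_nonneg _, hv⟩

theorem nonempty_of_unit {n : ℕ} {f : Fin n → ℝ} (hf : ∑ i, f i = 1) : Nonempty (Fin n) := by
  by_contra h
  rw [not_nonempty_iff] at h
  simp at hf

theorem one_div_rpow_inv_rpow {b ε : ℝ} (hb : 0 < b) (hε : ε ≠ 0) :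
    ((1 / b) ^ (1 / ε)) ^ ε = 1 / b := by
  rw [← Real.rpow_mul (by positivity), one_div_mul_cancel hε, Real.rpow_one]

theorem weights_lt {α a b : ℝ} (hα : 1 < α) (ha : 0 < a) (hab : a / 2 < b) :
    (1 / b) ^ (1 / (α - 1)) < (2 / a) ^ (1 / (α - 1)) := by
  have hb : 0 < b := by linarith
  have h : 1 / b < 2 / a := by
    rw [div_lt_div_iff₀ hb ha]
    linarith
  exact Real.rpow_lt_rpow (by positivity) h (one_div_pos.2 (by linarith))

/-! ### Lower bounds for the cost of a feasible matrix -/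

section LowerBounds

variable {n : ℕ} {A : Matrix (Fin n) (Fin n) ℂ} {α a b : ℝ} {ν₁ ν₂ : Measure UnitCircle}

theorem exists_profile_le_cost (hα : 1 < α) (hα2 : α < 2) (ha : 0 < a) (hab : a / 2 < b)
    (hA : A ∈ feasible ν₁ ν₂ n) :
    ∃ k : ℕ, 1 ≤ k ∧
      profile ((1 / b) ^ (1 / (α - 1))) ((2 / a) ^ (1 / (α - 1))) (α - 1) k ≤ cost α a b A := by
  have hb : 0 < b := by linarith
  obtain ⟨v, hv, hv1⟩ := exists_unit_eigenvector hA.2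
  have := nonempty_of_unit hv1
  have h := one_le_cost_mul hα ha hb hA.1.1 hv hv1 (fun _ _ => True) (by simp)
  simp only [if_true] at h
  obtain ⟨k, hk, -, hkle⟩ := exists_uniform_ge (s := (1 / b) ^ (1 / (α - 1)))
    (by positivity) (weights_lt hα ha hab) (one_lt_half_conj hα hα2) (sq_norm_mem_stdSimplex hv1)
  rw [← sum_sum_quad] at hkle
  refine ⟨k, hk, profile_le_of_one_le hα (by positivity) (by positivity)
    (cost_nonneg ha.le hb.le A) hk ?_ hkle h⟩
  exact sum_nonneg fun i _ => sum_nonneg fun j _ => by split_ifs <;> positivity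

/-- Here the diagonal coefficient dominates: replacing all coefficients by it gives a perfect
square, and `∑ pᵢ ^ γ ≤ ∑ pᵢ = 1`. -/
theorem le_cost_of_le_half (hα : 1 < α) (hα2 : α < 2) (ha : 0 < a) (hb : 0 < b)
    (hab : b ≤ a / 2) (hA : A ∈ feasible ν₁ ν₂ n) : b ≤ cost α a b A := by
  have hα1 : 0 < α - 1 := by linarith
  obtain ⟨v, hv, hv1⟩ := exists_unit_eigenvector hA.2
  have h := one_le_cost_mul hα ha hb hA.1.1 hv hv1 (fun _ _ => True) (by simp)
  simp only [if_true] at h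
  have hst : (2 / a) ^ (1 / (α - 1)) ≤ (1 / b) ^ (1 / (α - 1)) := by
    refine Real.rpow_le_rpow (by positivity) ?_ (by positivity)
    rw [div_le_div_iff₀ ha hb]
    linarith
  have hγ := one_lt_half_conj hα hα2
  set y : Fin n → ℝ := fun i => (‖v i‖ ^ 2) ^ (α / (α - 1) / 2) with hy
  have hy0 : ∀ i, 0 ≤ y i := fun i => by positivity
  have hy1 : ∑ i, y i ≤ 1 := by
    rw [← hv1]
    refine sum_le_sum fun i _ => ?_
    have hle : ‖v i‖ ^ 2 ≤ 1 := by
      rw [← hv1]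
      exact single_le_sum (f := fun i => ‖v i‖ ^ 2) (fun i _ => sq_nonneg _) (mem_univ i)
    calc y i ≤ (‖v i‖ ^ 2) ^ (1 : ℝ) :=
          Real.rpow_le_rpow_of_exponent_ge' (by positivity) hle zero_le_one hγ.le
      _ = _ := Real.rpow_one _
  have hQ : ∑ i, ∑ j, (if i = j then (1 / b) ^ (1 / (α - 1)) else (2 / a) ^ (1 / (α - 1))) *
      (y i * y j) ≤ (1 / b) ^ (1 / (α - 1)) := by
    calc _ ≤ ∑ i, ∑ j, (1 / b) ^ (1 / (α - 1)) * (y i * y j) := by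
          refine sum_le_sum fun i _ => sum_le_sum fun j _ =>
            mul_le_mul_of_nonneg_right ?_ (mul_nonneg (hy0 i) (hy0 j))
          split_ifs
          · exact le_rfl
          · exact hst
      _ = (1 / b) ^ (1 / (α - 1)) * (∑ i, y i) ^ 2 := by
          rw [sq, sum_mul_sum]
          simp only [mul_sum]
      _ ≤ (1 / b) ^ (1 / (α - 1)) * 1 :=
          mul_le_mul_of_nonneg_left (pow_le_one₀ (sum_nonneg fun i _ => hy0 i) hy1)
            (by positivity)
      _ = _ := mul_one _
  have := one_div_rpow_le_of_one_le (cost_nonneg ha.le hb.le A) hα1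
    (sum_nonneg fun i _ => sum_nonneg fun j _ => by split_ifs <;> positivity) hQ (by positivity) h
  rwa [one_div_rpow_inv_rpow hb hα1.ne', one_div_one_div] at this

theorem re_star_mul_diag_nonpos {v : Fin n → ℂ} (hA : A.IsHermitian) {i : Fin n}
    (hi : (A i i).re ≤ 0) : (star (v i) * A i i * v i).re ≤ 0 := by
  have h1 : star (v i) * A i i * v i = ((A i i).re * ‖v i‖ ^ 2 : ℝ) := by
    have h2 : A i i = ((A i i).re : ℂ) := Complex.ext rfl (by simp [hA.im_diag i])
    rw [mul_right_comm, Complex.star_def, ← Complex.normSq_eq_conj_mul_self,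
      Complex.normSq_eq_norm_sq, h2]
    simp only [Complex.ofReal_re]
    push_cast
    ring
  rw [h1, Complex.ofReal_re]
  exact mul_nonpos_of_nonpos_of_nonneg hi (sq_nonneg _)

/-- The diagonal of a Hermitian matrix is real, so without the angle 1 it is nonpositive and can be
dropped: the simplex problem has `s = 0`. -/
theorem exists_profile_zero_le_cost (hα : 1 < α) (hα2 : α < 2) (ha : 0 < a) (hb : 0 < b)
    (h1 : 1 ∉ ν₁.support) (hA : A ∈ feasible ν₁ ν₂ n) :
    ∃ k : ℕ, 2 ≤ k ∧ profile 0 ((2 / a) ^ (1 / (α - 1))) (α - 1) k ≤ cost α a b A := by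
  obtain ⟨v, hv, hv1⟩ := exists_unit_eigenvector hA.2
  have := nonempty_of_unit hv1
  have h := one_le_cost_mul hα ha hb hA.1.1 hv hv1 (fun i j => i ≠ j) (by
    intro i j hij
    push Not at hij
    subst hij
    exact re_star_mul_diag_nonpos hA.1.1 ((hA.1.2.1 i).re_nonpos h1 (hA.1.1.im_diag i)))
  obtain ⟨k, hk, -, hkle⟩ := exists_uniform_ge (s := 0) (t := (2 / a) ^ (1 / (α - 1)))
    le_rfl (by positivity) (one_lt_half_conj hα hα2) (sq_norm_mem_stdSimplex hv1)
  rw [← sum_sum_quad] at hkle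
  have hQ : ∀ i j, (if i ≠ j then
      (if i = j then (1 / b) ^ (1 / (α - 1)) else (2 / a) ^ (1 / (α - 1))) *
        ((‖v i‖ ^ 2) ^ (α / (α - 1) / 2) * (‖v j‖ ^ 2) ^ (α / (α - 1) / 2)) else 0) =
      (if i = j then 0 else (2 / a) ^ (1 / (α - 1))) *
        ((‖v i‖ ^ 2) ^ (α / (α - 1) / 2) * (‖v j‖ ^ 2) ^ (α / (α - 1) / 2)) := by
    intro i j
    split_ifs <;> simp_all
  simp only [hQ] at h
  have hQ0 : 0 ≤ ∑ i, ∑ j, (if i = j then 0 else (2 / a) ^ (1 / (α - 1))) *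
      ((‖v i‖ ^ 2) ^ (α / (α - 1) / 2) * (‖v j‖ ^ 2) ^ (α / (α - 1) / 2)) :=
    sum_nonneg fun i _ => sum_nonneg fun j _ => by split_ifs <;> positivity
  refine ⟨k, ?_, profile_le_of_one_le hα le_rfl (by positivity)
    (cost_nonneg ha.le hb.le A) hk hQ0 hkle h⟩
  -- For `k = 1` and `s = 0` the uniform value is 0, which contradicts the Hölder bound.
  by_contra hk2
  have hk1 : k = 1 := by omega
  simp only [hk1, Nat.cast_one, sub_self, zero_mul, add_zero, mul_zero] at hkle
  rw [le_antisymm hkle hQ0, Real.zero_rpow (by linarith)] at h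
  linarith

theorem sum_rpow_le_rpow_sum {ι : Type*} (S : Finset ι) {f : ι → ℝ} (hf : ∀ i, 0 ≤ f i) {γ : ℝ}
    (hγ : 1 < γ) : ∑ i ∈ S, f i ^ γ ≤ (∑ i ∈ S, f i) ^ γ := by
  have hs : 0 ≤ ∑ i ∈ S, f i := sum_nonneg fun i _ => hf i
  have hsplit : ∀ x : ℝ, 0 ≤ x → x ^ γ = x * x ^ (γ - 1) := fun x hx => by
    conv_rhs => rw [← Real.rpow_one_add' hx (by linarith), add_sub_cancel]
  rw [hsplit _ hs, sum_mul]
  refine sum_le_sum fun i hi => ?_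
  rw [hsplit _ (hf i)]
  exact mul_le_mul_of_nonneg_left (Real.rpow_le_rpow (hf i)
    (single_le_sum (fun i _ => hf i) hi) (by linarith)) (hf i)

/-- When only pairs of opposite signs interact, at most two points matter. -/
theorem exists_le_two_sign_sum_le {σ t γ : ℝ} (hσ : 0 ≤ σ) (hσt : σ < t) (hγ : 1 < γ)
    {u : Fin n → ℝ} (hu : ∑ i, u i ^ 2 = 1) :
    ∃ k : ℕ, 1 ≤ k ∧ k ≤ 2 ∧ ∑ i, ∑ j, (if i = j then σ * ((u i ^ 2) ^ γ * (u j ^ 2) ^ γ)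
        else if u i * u j < 0 then t * ((u i ^ 2) ^ γ * (u j ^ 2) ^ γ) else 0) ≤
      (k : ℝ) ^ (1 - 2 * γ) * (σ + (k - 1) * t) := by
  have hγ0 : γ ≠ 0 := by linarith
  -- Superadditivity of `x ↦ x ^ γ` lets the mass of each sign be merged into one point, `x` or `z`.
  -- Only the cross products of `P` and `N` carry `t`.
  set P : Fin n → ℝ := fun i => if 0 < u i then (u i ^ 2) ^ γ else 0 with hP
  set N : Fin n → ℝ := fun i => if u i < 0 then (u i ^ 2) ^ γ else 0 with hN
  set x := ∑ i with 0 < u i, u i ^ 2 with hx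
  set z := ∑ i with u i < 0, u i ^ 2 with hz
  have hP0 : ∀ i, 0 ≤ P i := fun i => by simp only [hP]; split_ifs <;> positivity
  have hN0 : ∀ i, 0 ≤ N i := fun i => by simp only [hN]; split_ifs <;> positivity
  have hx0 : 0 ≤ x := sum_nonneg fun i _ => sq_nonneg _
  have hz0 : 0 ≤ z := sum_nonneg fun i _ => sq_nonneg _
  have hxz : x + z = 1 := by
    rw [hx, hz, sum_filter, sum_filter, ← sum_add_distrib, ← hu]
    refine sum_congr rfl fun i _ => ?_
    rcases lt_trichotomy (u i) 0 with h | h | h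
    · simp [h, h.le]
    · simp [h]
    · simp [h, h.le]
  have hPx : ∑ i, P i ≤ x ^ γ := by
    rw [← sum_filter]
    exact sum_rpow_le_rpow_sum _ (fun i => sq_nonneg _) hγ
  have hNz : ∑ i, N i ≤ z ^ γ := by
    rw [← sum_filter]
    exact sum_rpow_le_rpow_sum _ (fun i => sq_nonneg _) hγ
  have hterm : ∀ i j, (if i = j then σ * ((u i ^ 2) ^ γ * (u j ^ 2) ^ γ)
      else if u i * u j < 0 then t * ((u i ^ 2) ^ γ * (u j ^ 2) ^ γ) else 0) ≤
      σ * (P i * P j + N i * N j) + t * (P i * N j + N i * P j) := by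
    intro i j
    have ht : 0 < t := by linarith
    split_ifs with hij hneg
    · subst hij
      rcases lt_trichotomy (u i) 0 with h | h | h
      · simp [hP, hN, h, not_lt.2 h.le]
      · simp [hP, hN, h, Real.zero_rpow hγ0]
      · simp [hP, hN, h, not_lt.2 h.le]
    · rcases mul_neg_iff.1 hneg with ⟨h1, h2⟩ | ⟨h1, h2⟩
      · simp [hP, hN, h1, h2, not_lt.2 h1.le, not_lt.2 h2.le]
      · simp [hP, hN, h1, h2, not_lt.2 h1.le, not_lt.2 h2.le]
    · have := hP0 i; have := hP0 j; have := hN0 i; have := hN0 j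
      positivity
  obtain ⟨k, hk, hk2, hkle⟩ := exists_uniform_ge hσ hσt hγ (p := ![x, z])
    ⟨fun i => by fin_cases i <;> simpa, by simpa using hxz⟩
  refine ⟨k, hk, by simpa using hk2, le_trans ?_ hkle⟩
  calc _ ≤ ∑ i, ∑ j, (σ * (P i * P j + N i * N j) + t * (P i * N j + N i * P j)) :=
        sum_le_sum fun i _ => sum_le_sum fun j _ => hterm i j
    _ = σ * ((∑ i, P i) * ∑ i, P i + (∑ i, N i) * ∑ i, N i) +
        t * ((∑ i, P i) * ∑ i, N i + (∑ i, N i) * ∑ i, P i) := by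
        simp only [sum_add_distrib, ← mul_sum, sum_mul_sum]
    _ ≤ σ * (x ^ γ * x ^ γ + z ^ γ * z ^ γ) + t * (x ^ γ * z ^ γ + z ^ γ * x ^ γ) := by
        have := sum_nonneg fun i (_ : i ∈ univ) => hP0 i
        have := sum_nonneg fun i (_ : i ∈ univ) => hN0 i
        have : 0 ≤ t := by linarith
        gcongr
    _ = _ := by
        simp only [Fin.sum_univ_two, cons_val_zero, cons_val_one]
        ring

theorem apply_eq_neg_norm (h2 : ν₂.support = {-1}) (hA : A ∈ domain ν₁ ν₂ n) {i j : Fin n}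
    (hij : i ≠ j) : A i j = ((-‖A i j‖ : ℝ) : ℂ) := by
  rcases hij.lt_or_gt with h | h
  · simpa using (hA.2.2 i j h).eq_neg_norm h2
  · rw [hA.1.norm_apply_comm i j, ← hA.1.apply i j]
    conv_lhs => rw [(hA.2.2 j i h).eq_neg_norm h2]
    simp

theorem exists_real_eigenvector_of_feasible (h2 : ν₂.support = {-1})
    (hA : A ∈ feasible ν₁ ν₂ n) :
    ∃ u : Fin n → ℝ, (A *ᵥ fun i => (u i : ℂ)) = (fun i => (u i : ℂ)) ∧ ∑ i, u i ^ 2 = 1 := by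
  refine exists_real_unit_eigenvector hA.2 fun i j => ?_
  by_cases hij : i = j
  · rw [hij]; exact hA.1.1.im_diag j
  · rw [apply_eq_neg_norm h2 hA.1 hij, Complex.ofReal_im]

theorem re_star_mul_nonpos_of_sign (h2 : ν₂.support = {-1}) (hA : A ∈ domain ν₁ ν₂ n)
    {i j : Fin n} (hij : i ≠ j) {u : Fin n → ℝ} (hu : ¬ u i * u j < 0) :
    (star (u i : ℂ) * A i j * (u j : ℂ)).re ≤ 0 := by
  rw [apply_eq_neg_norm h2 hA hij, Complex.star_def, Complex.conj_ofReal, ← Complex.ofReal_mul,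
    ← Complex.ofReal_mul, Complex.ofReal_re]
  have := mul_nonneg (not_lt.1 hu) (norm_nonneg (A i j))
  linarith

theorem exists_le_two_profile_le_cost (hα : 1 < α) (hα2 : α < 2) (ha : 0 < a) (hab : a / 2 < b)
    (h2 : ν₂.support = {-1}) (hA : A ∈ feasible ν₁ ν₂ n) :
    ∃ k : ℕ, 1 ≤ k ∧ k ≤ 2 ∧
      profile ((1 / b) ^ (1 / (α - 1))) ((2 / a) ^ (1 / (α - 1))) (α - 1) k ≤ cost α a b A := by
  have hb : 0 < b := by linarith
  obtain ⟨u, hv, hu1⟩ := exists_real_eigenvector_of_feasible h2 hA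
  have h := one_le_cost_mul hα ha hb hA.1.1 hv (by simpa using hu1)
    (fun i j => i = j ∨ u i * u j < 0) (by
      intro i j hij
      push Not at hij
      exact re_star_mul_nonpos_of_sign h2 hA.1 hij.1 (not_lt.2 hij.2))
  obtain ⟨k, hk, hk2, hkle⟩ := exists_le_two_sign_sum_le (σ := (1 / b) ^ (1 / (α - 1)))
    (by positivity) (weights_lt hα ha hab) (one_lt_half_conj hα hα2) hu1
  refine ⟨k, hk, hk2, profile_le_of_one_le hα (by positivity) (by positivity)
    (cost_nonneg ha.le hb.le A) hk ?_ hkle ?_⟩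
  · exact sum_nonneg fun i _ => sum_nonneg fun j _ => by split_ifs <;> positivity
  · convert! h using 3
    refine sum_congr rfl fun i _ => sum_congr rfl fun j _ => ?_
    by_cases hij : i = j <;> simp [hij]

/-- Both reductions apply: `s = 0` excludes `k = 1` and the signs force `k ≤ 2`. The profile at 2 is
`2 / (2 / a) = a`. -/
theorem le_cost_of_neg_neg (hα : 1 < α) (hα2 : α < 2) (ha : 0 < a) (hb : 0 < b)
    (h1 : 1 ∉ ν₁.support) (h2 : ν₂.support = {-1}) (hA : A ∈ feasible ν₁ ν₂ n) :
    a ≤ cost α a b A := by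
  have hα1 : 0 < α - 1 := by linarith
  obtain ⟨u, hv, hu1⟩ := exists_real_eigenvector_of_feasible h2 hA
  have h := one_le_cost_mul hα ha hb hA.1.1 hv (by simpa using hu1)
    (fun i j => u i * u j < 0) (by
      intro i j hij
      by_cases hij' : i = j
      · subst hij'
        exact re_star_mul_diag_nonpos (v := fun i => (u i : ℂ)) hA.1.1
          ((hA.1.2.1 i).re_nonpos h1 (hA.1.1.im_diag i))
      · exact re_star_mul_nonpos_of_sign h2 hA.1 hij' hij)
  obtain ⟨k, hk, hk2, hkle⟩ := exists_le_two_sign_sum_le (σ := 0)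
    (t := (2 / a) ^ (1 / (α - 1))) le_rfl (by positivity) (one_lt_half_conj hα hα2) hu1
  set Q := ∑ i, ∑ j, (if i = j then 0 * ((u i ^ 2) ^ (α / (α - 1) / 2) *
    (u j ^ 2) ^ (α / (α - 1) / 2)) else if u i * u j < 0 then (2 / a) ^ (1 / (α - 1)) *
      ((u i ^ 2) ^ (α / (α - 1) / 2) * (u j ^ 2) ^ (α / (α - 1) / 2)) else 0) with hQdef
  have hQ0 : 0 ≤ Q :=
    sum_nonneg fun i _ => sum_nonneg fun j _ => by split_ifs <;> positivity
  have hQ1 : 1 ≤ cost α a b A * Q ^ (α - 1) := by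
    convert! h using 3
    refine sum_congr rfl fun i _ => sum_congr rfl fun j _ => ?_
    by_cases hij : i = j
    · subst hij
      simp [not_lt.2 (mul_self_nonneg (u i))]
    · simp [hij]
  have hk' : k = 2 := by
    by_contra hne
    have hk1 : k = 1 := by omega
    simp only [hk1, Nat.cast_one, sub_self, zero_mul, add_zero, mul_zero] at hkle
    rw [le_antisymm hkle hQ0, Real.zero_rpow hα1.ne'] at hQ1
    linarith
  have hfin := profile_le_of_one_le hα le_rfl (by positivity) (cost_nonneg ha.le hb.le A) hk hQ0
    hkle hQ1
  rw [hk', profile, Nat.cast_ofNat, zero_add, show (2 : ℝ) - 1 = 1 by norm_num, one_mul,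
    ← Real.rpow_mul (by positivity), one_div_mul_cancel hα1.ne', Real.rpow_one] at hfin
  rwa [div_div_cancel₀ (two_ne_zero)] at hfin

theorem mul_norm_rpow_le_cost (ha : 0 ≤ a) (hb : 0 ≤ b) (hA : A.IsHermitian) {i j : Fin n}
    (hij : i ≠ j) : a * ‖A i j‖ ^ α ≤ cost α a b A := by
  wlog hlt : i < j generalizing i j
  · rw [hA.norm_apply_comm i j]
    exact this hij.symm (hij.symm.lt_of_le (not_lt.1 hlt))
  have h1 : ‖A i j‖ ^ α ≤ ∑ j ∈ Ioi i, ‖A i j‖ ^ α :=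
    single_le_sum (f := fun j => ‖A i j‖ ^ α) (fun j _ => by positivity) (mem_Ioi.2 hlt)
  have h2 : ∑ j ∈ Ioi i, ‖A i j‖ ^ α ≤ ∑ i, ∑ j ∈ Ioi i, ‖A i j‖ ^ α :=
    single_le_sum (f := fun i => ∑ j ∈ Ioi i, ‖A i j‖ ^ α)
      (fun i _ => sum_nonneg fun j _ => by positivity) (mem_univ i)
  have h3 : 0 ≤ b * ∑ i, ‖A i i‖ ^ α :=
    mul_nonneg hb (sum_nonneg fun i _ => by positivity)
  have h4 := mul_le_mul_of_nonneg_left (h1.trans h2) ha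
  unfold cost
  linarith

theorem mul_norm_diag_rpow_le_cost (ha : 0 ≤ a) (hb : 0 ≤ b) (i : Fin n) :
    b * ‖A i i‖ ^ α ≤ cost α a b A := by
  have h1 : ‖A i i‖ ^ α ≤ ∑ i, ‖A i i‖ ^ α :=
    single_le_sum (f := fun i => ‖A i i‖ ^ α) (fun j _ => by positivity) (mem_univ i)
  have h3 : 0 ≤ a * ∑ i, ∑ j ∈ Ioi i, ‖A i j‖ ^ α :=
    mul_nonneg ha (sum_nonneg fun i _ => sum_nonneg fun j _ => by positivity)
  have h4 := mul_le_mul_of_nonneg_left h1 hb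
  unfold cost
  linarith

/-- A single relevant entry of modulus at least 1 already costs `m`. Otherwise `|Aᵢⱼ| ≤ |Aᵢⱼ| ^ α`,
and the quadratic form is compared with the cost term by term. -/
theorem le_cost_of_le_one {m : ℝ} (hα0 : 0 < α) (hα1 : α ≤ 1) (ha : 0 < a) (hb : 0 < b)
    (hm : 0 < m) (hma : m ≤ a) (hmb : m ≤ b ∨ 1 ∉ ν₁.support) (hA : A ∈ feasible ν₁ ν₂ n) :
    m ≤ cost α a b A := by
  by_cases hoff : ∃ i j, i ≠ j ∧ 1 ≤ ‖A i j‖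
  · obtain ⟨i, j, hij, h1⟩ := hoff
    have h2 := mul_le_mul_of_nonneg_left (Real.one_le_rpow h1 hα0.le) ha.le
    have h3 := mul_norm_rpow_le_cost (α := α) ha.le hb.le hA.1.1 hij
    linarith
  by_cases hdiag : m ≤ b ∧ ∃ i, 1 ≤ ‖A i i‖
  · obtain ⟨hmb, i, h1⟩ := hdiag
    have h2 := mul_le_mul_of_nonneg_left (Real.one_le_rpow h1 hα0.le) hb.le
    have h3 := mul_norm_diag_rpow_le_cost (α := α) (A := A) ha.le hb.le i
    linarith
  push Not at hoff hdiag
  obtain ⟨v, hv, hv1⟩ := exists_unit_eigenvector hA.2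
  have hpow : ∀ x : ℝ, 0 ≤ x → x ≤ 1 → x ≤ x ^ α := fun x h0 h1 => by
    simpa using Real.rpow_le_rpow_of_exponent_ge' h0 h1 hα0.le hα1
  rw [cost_eq_sum hA.1.1, ← mul_one m, one_eq_sum_re hv hv1, mul_sum]
  refine sum_le_sum fun i _ => ?_
  rw [mul_sum]
  refine sum_le_sum fun j _ => ?_
  have hre := re_star_mul_le A v i j
  split_ifs with hij
  · subst hij
    by_cases h1 : 1 ∉ ν₁.support
    · have h2 : (star (v i) * A i i * v i).re ≤ 0 := re_star_mul_diag_nonpos hA.1.1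
        ((hA.1.2.1 i).re_nonpos h1 (hA.1.1.im_diag i))
      exact (mul_nonpos_of_nonneg_of_nonpos hm.le h2).trans (by positivity)
    · have hmb' : m ≤ b := hmb.resolve_right h1
      have hv2 : ‖v i‖ * ‖v i‖ ≤ 1 := by
        rw [← sq, ← hv1]
        exact single_le_sum (f := fun i => ‖v i‖ ^ 2) (fun i _ => sq_nonneg _) (mem_univ i)
      have h2 : (star (v i) * A i i * v i).re ≤ ‖A i i‖ ^ α :=
        hre.trans ((mul_le_of_le_one_right (norm_nonneg _) hv2).trans
          (hpow _ (norm_nonneg _) (hdiag hmb' i).le))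
      exact (mul_le_mul_of_nonneg_left h2 hm.le).trans
        (mul_le_mul_of_nonneg_right hmb' (by positivity))
  -- This `1 / 2` matches the weight `a / 2` of an off-diagonal entry.
  · have hv2 : ‖v i‖ * ‖v j‖ ≤ 1 / 2 := by
      have h1 : ‖v i‖ ^ 2 + ‖v j‖ ^ 2 ≤ 1 := by
        rw [← hv1, ← sum_pair hij (f := fun i => ‖v i‖ ^ 2)]
        exact sum_le_sum_of_subset_of_nonneg (subset_univ _) fun i _ _ => sq_nonneg _
      nlinarith [sq_nonneg (‖v i‖ - ‖v j‖)]
    have h2 := hpow _ (norm_nonneg _) (hoff i j hij).le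
    calc m * (star (v i) * A i j * v j).re ≤ m * (‖A i j‖ * (1 / 2)) :=
          mul_le_mul_of_nonneg_left (hre.trans
            (mul_le_mul_of_nonneg_left hv2 (norm_nonneg _))) hm.le
      _ = m / 2 * ‖A i j‖ := by ring
      _ ≤ a / 2 * ‖A i j‖ ^ α := mul_le_mul (by linarith) h2 (norm_nonneg _) (by positivity)

end LowerBounds

/-! ### Minimizing the profile over the integers -/

section Profile

variable {s t ε : ℝ}

theorem hasDerivAt_profile {x : ℝ} (hD : 0 < s + (x - 1) * t) :
    HasDerivAt (profile s t ε)
      ((s + (x - 1) * t) ^ (-ε - 1) * ((1 - ε) * t * x - (t - s))) x := by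
  have h1 : HasDerivAt (fun x : ℝ => s + (x - 1) * t) t x := by
    simpa using (((hasDerivAt_id' x).sub_const 1).mul_const t).const_add s
  have h2 := (hasDerivAt_id' x).mul (h1.rpow_const (p := -ε) (Or.inl hD.ne'))
  have hev : profile s t ε =ᶠ[nhds x]
      ((fun x => x) * fun y => (s + (y - 1) * t) ^ (-ε)) := by
    filter_upwards [h1.continuousAt.eventually (lt_mem_nhds hD)] with z hz
    simp only [profile, Pi.mul_apply]
    rw [Real.rpow_neg hz.le, div_eq_mul_inv]
  convert! h2.congr_of_eventuallyEq hev using 1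
  have h4 : (s + (x - 1) * t) ^ (-ε) = (s + (x - 1) * t) ^ (-ε - 1) * (s + (x - 1) * t) := by
    rw [← Real.rpow_add_one hD.ne']; ring_nf
  rw [h4]
  ring

theorem profile_le_of_le_turning {x y : ℝ} (ht : 0 < t) (hε : ε < 1)
    (hD : 0 < s + (x - 1) * t) (hxy : x ≤ y) (hy : y ≤ 1 / (1 - ε) * (1 - s / t)) :
    profile s t ε y ≤ profile s t ε x := by
  have hDz : ∀ z ∈ Set.Icc x y, 0 < s + (z - 1) * t := fun z hz => by
    nlinarith [hz.1]
  refine antitoneOn_of_deriv_nonpos (convex_Icc x y)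
    (fun z hz => (hasDerivAt_profile (hDz z hz)).continuousAt.continuousWithinAt)
    (fun z hz => (hasDerivAt_profile
      (hDz z (interior_subset hz))).differentiableAt.differentiableWithinAt)
    (fun z hz => ?_) (Set.left_mem_Icc.2 hxy) (Set.right_mem_Icc.2 hxy) hxy
  have hz' := interior_subset hz
  rw [(hasDerivAt_profile (hDz z hz')).deriv]
  refine mul_nonpos_of_nonneg_of_nonpos (Real.rpow_nonneg (hDz z hz').le _) ?_
  have h1 : z ≤ 1 / (1 - ε) * (1 - s / t) := hz'.2.trans hy
  have h2 : (1 - ε) * t * (1 / (1 - ε) * (1 - s / t)) = t - s := by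
    have : 1 - ε ≠ 0 := by linarith
    field_simp
  have h3 : 0 < (1 - ε) * t := mul_pos (by linarith) ht
  nlinarith [mul_le_mul_of_nonneg_left h1 h3.le]

theorem profile_le_of_turning_le {x y : ℝ} (ht : 0 < t) (hε : ε < 1)
    (hD : 0 < s + (x - 1) * t) (hxy : x ≤ y) (hx : 1 / (1 - ε) * (1 - s / t) ≤ x) :
    profile s t ε x ≤ profile s t ε y := by
  have hDz : ∀ z ∈ Set.Icc x y, 0 < s + (z - 1) * t := fun z hz => by
    nlinarith [hz.1]
  refine monotoneOn_of_deriv_nonneg (convex_Icc x y)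
    (fun z hz => (hasDerivAt_profile (hDz z hz)).continuousAt.continuousWithinAt)
    (fun z hz => (hasDerivAt_profile
      (hDz z (interior_subset hz))).differentiableAt.differentiableWithinAt)
    (fun z hz => ?_) (Set.left_mem_Icc.2 hxy) (Set.right_mem_Icc.2 hxy) hxy
  have hz' := interior_subset hz
  rw [(hasDerivAt_profile (hDz z hz')).deriv]
  refine mul_nonneg (Real.rpow_nonneg (hDz z hz').le _) ?_
  have h1 : 1 / (1 - ε) * (1 - s / t) ≤ z := hx.trans hz'.1
  have h2 : (1 - ε) * t * (1 / (1 - ε) * (1 - s / t)) = t - s := by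
    have : 1 - ε ≠ 0 := by linarith
    field_simp
  have h3 : 0 < (1 - ε) * t := mul_pos (by linarith) ht
  nlinarith [mul_le_mul_of_nonneg_left h1 h3.le]

/-- Over the integers `k ≥ m`, the profile is minimal at one of the two integers next to the
turning point. -/
theorem min_profile_le {m : ℤ} {x₀ : ℝ} (ht : 0 < t) (hε : ε < 1)
    (hx₀ : x₀ = 1 / (1 - ε) * (1 - s / t)) (hD : 0 < s + (m - 1) * t) (hm : m ≤ ⌈x₀⌉)
    {k : ℤ} (hk : m ≤ k) :
    min (profile s t ε (max m ⌊x₀⌋ : ℤ)) (profile s t ε (⌈x₀⌉ : ℤ)) ≤ profile s t ε k := by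
  have hDz : ∀ z : ℤ, m ≤ z → 0 < s + ((z : ℝ) - 1) * t := fun z hz => by
    have : (m : ℝ) ≤ z := by exact_mod_cast hz
    nlinarith
  subst hx₀
  rcases le_or_gt (k : ℝ) (1 / (1 - ε) * (1 - s / t)) with h | h
  · have h1 : k ≤ ⌊1 / (1 - ε) * (1 - s / t)⌋ := Int.le_floor.2 h
    -- An admissible `k` below the turning point forces the floor to be at least `m`; the truncation
    -- matters only when there is no such `k`, and then the ceiling suffices.
    rw [max_eq_right (hk.trans h1)]
    exact min_le_of_left_le (profile_le_of_le_turning ht hε (hDz k hk) (by exact_mod_cast h1)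
      (Int.floor_le _))
  · have h1 : ⌈1 / (1 - ε) * (1 - s / t)⌉ ≤ k := Int.ceil_le.2 h.le
    exact min_le_of_right_le (profile_le_of_turning_le ht hε (hDz _ hm) (by exact_mod_cast h1)
      (Int.le_ceil _))

end Profile

/-! ### Matrices attaining the bounds -/

variable {α a b : ℝ} {ν₁ ν₂ : Measure UnitCircle}

theorem rateConst_le {n : ℕ} (ha : 0 ≤ a) (hb : 0 ≤ b) (hn : 1 ≤ n)
    {A : Matrix (Fin n) (Fin n) ℂ} (hA : A ∈ feasible ν₁ ν₂ n) :
    rateConst α a b ν₁ ν₂ ≤ cost α a b A :=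
  csInf_le ⟨0, by rintro r ⟨n, -, A, -, rfl⟩; exact cost_nonneg ha hb A⟩ ⟨n, hn, A, hA, rfl⟩

theorem le_rateConst {n : ℕ} (hn : 1 ≤ n) {A : Matrix (Fin n) (Fin n) ℂ}
    (hA : A ∈ feasible ν₁ ν₂ n) {m : ℝ}
    (h : ∀ (n : ℕ) (A : Matrix (Fin n) (Fin n) ℂ), A ∈ feasible ν₁ ν₂ n → m ≤ cost α a b A) :
    m ≤ rateConst α a b ν₁ ν₂ :=
  le_csInf ⟨_, n, hn, A, hA, rfl⟩ (by rintro r ⟨n, -, A, hA, rfl⟩; exact h n A hA)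

/-- The entries are nonnegative with rows summing to 1, so the constant vector is an eigenvector for
the largest eigenvalue. An angle condition is void when the entries concerned vanish or do not
exist. -/
theorem B_mem_feasible {n : ℕ} {s t : ℝ} (hn : 1 ≤ n) (hs : 0 ≤ s) (ht : 0 ≤ t)
    (hD : 0 < s + ((n : ℝ) - 1) * t) (h1 : s = 0 ∨ 1 ∈ ν₁.support)
    (h2 : n = 1 ∨ 1 ∈ ν₂.support) : B n s t ∈ feasible ν₁ ν₂ n := by
  have hrow : ∀ i : Fin n, ∑ j, (if i = j then s else t) / (s + ((n : ℝ) - 1) * t) = 1 := by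
    intro i
    rw [← sum_div, ← add_sum_erase univ _ (mem_univ i), if_pos rfl,
      sum_congr rfl fun j hj => if_neg (ne_of_mem_erase hj).symm, sum_const,
      card_erase_of_mem (mem_univ i), card_univ, Fintype.card_fin, nsmul_eq_mul, Nat.cast_sub hn,
      Nat.cast_one, div_self hD.ne']
  refine ⟨⟨?_, fun i => ?_, fun i j hij => ?_⟩, ?_⟩
  · ext i j
    simp [B, eq_comm]
  · rcases h1 with rfl | h1
    · simp [B, angleIn_zero]
    · simp only [B, of_apply, if_true]
      exact angleIn_ofReal h1 (by positivity)
  · rcases h2 with rfl | h2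
    · exact absurd (Subsingleton.elim i j) hij.ne
    · simp only [B, of_apply, if_neg hij.ne]
      exact angleIn_ofReal h2 (by positivity)
  · refine largestEigenvalue_eq_one (v := fun _ => 1) (fun h => ?_) ?_ fun i => ?_
    · exact one_ne_zero (congrFun h ⟨0, hn⟩)
    · funext i
      simp only [mulVec, dotProduct, B, of_apply, mul_one]
      exact_mod_cast hrow i
    · rw [← hrow i]
      refine (sum_congr rfl fun j _ => ?_).le
      simp only [B, of_apply, Complex.norm_real]
      exact Real.norm_of_nonneg (div_nonneg (by split_ifs <;> assumption) hD.le)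

theorem cost_B {n : ℕ} {s t : ℝ} (hn : 1 ≤ n) (hs : 0 ≤ s) (ht : 0 ≤ t)
    (hD : 0 < s + ((n : ℝ) - 1) * t) :
    cost α a b (B n s t) =
      n * (b * s ^ α + (n - 1) * (a / 2 * t ^ α)) / (s + ((n : ℝ) - 1) * t) ^ α := by
  have hherm : (B n s t).IsHermitian := by
    ext i j
    simp [B, eq_comm]
  have hentry : ∀ i j : Fin n, (if i = j then b else a / 2) * ‖B n s t i j‖ ^ α =
      (if i = j then b * s ^ α else a / 2 * t ^ α) / (s + ((n : ℝ) - 1) * t) ^ α := by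
    intro i j
    simp only [B, of_apply, Complex.norm_real]
    rw [Real.norm_of_nonneg (div_nonneg (by split_ifs <;> assumption) hD.le),
      Real.div_rpow (by split_ifs <;> assumption) hD.le]
    split_ifs <;> ring
  have hrow : ∀ i : Fin n, ∑ j, (if i = j then b * s ^ α else a / 2 * t ^ α) =
      b * s ^ α + (n - 1) * (a / 2 * t ^ α) := by
    intro i
    rw [← add_sum_erase univ _ (mem_univ i), if_pos rfl,
      sum_congr rfl fun j hj => if_neg (ne_of_mem_erase hj).symm, sum_const,
      card_erase_of_mem (mem_univ i), card_univ, Fintype.card_fin, nsmul_eq_mul, Nat.cast_sub hn,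
      Nat.cast_one]
  rw [cost_eq_sum hherm]
  simp only [hentry, ← sum_div, hrow, sum_const, card_univ, Fintype.card_fin, nsmul_eq_mul]

/-- The equality case of Hölder: it makes the numerator of the cost of `B n s t` equal to `n (s + (n
- 1) t)`, which cancels one power of the denominator. -/
theorem mul_rpow_weight {c : ℝ} (hα : 1 < α) (hc : 0 < c) :
    c * ((1 / c) ^ (1 / (α - 1))) ^ α = (1 / c) ^ (1 / (α - 1)) := by
  have hα1 : α - 1 ≠ 0 := by linarith
  have h0 : 0 < (1 / c) ^ (1 / (α - 1)) := by positivity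
  have h1 : ((1 / c) ^ (1 / (α - 1))) ^ α =
      ((1 / c) ^ (1 / (α - 1))) ^ (α - 1) * (1 / c) ^ (1 / (α - 1)) := by
    rw [← Real.rpow_add_one h0.ne', sub_add_cancel]
  rw [h1, one_div_rpow_inv_rpow hc hα1, ← mul_assoc, mul_one_div_cancel hc.ne', one_mul]

theorem mul_rpow_half_weight (hα : 1 < α) (ha : 0 < a) :
    a / 2 * ((2 / a) ^ (1 / (α - 1))) ^ α = (2 / a) ^ (1 / (α - 1)) := by
  have := mul_rpow_weight hα (half_pos ha)
  rwa [one_div_div] at this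

theorem div_rpow_eq_profile {s t : ℝ} {k : ℝ} (hD : 0 < s + (k - 1) * t) :
    k * (s + (k - 1) * t) / (s + (k - 1) * t) ^ α = profile s t (α - 1) k := by
  have h1 : (s + (k - 1) * t) ^ α = (s + (k - 1) * t) ^ (α - 1) * (s + (k - 1) * t) := by
    rw [← Real.rpow_add_one hD.ne', sub_add_cancel]
  rw [h1, mul_div_mul_right _ _ hD.ne', profile]

/-- The matrix `!![p, q; conj q, p]`. -/
noncomputable def pairMatrix (p : ℝ) (q : ℂ) : Matrix (Fin 2) (Fin 2) ℂ :=
  !![(p : ℂ), q; star q, (p : ℂ)]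

/-- The vector `(q, |q|)` absorbs the phase of `q`, so any off-diagonal angle is allowed. -/
theorem pairMatrix_mem_feasible {p : ℝ} {q : ℂ} (hp : 0 ≤ p) (hq : q ≠ 0) (hpq : p + ‖q‖ = 1)
    (h1 : p = 0 ∨ 1 ∈ ν₁.support) (h2 : AngleIn ν₂ q) : pairMatrix p q ∈ feasible ν₁ ν₂ 2 := by
  have hdiag : AngleIn ν₁ (p : ℂ) := by
    rcases h1 with rfl | h1
    · exact Or.inl (by simp)
    · exact angleIn_ofReal h1 hp
  have hpq' : (p : ℂ) + (‖q‖ : ℂ) = 1 := by exact_mod_cast hpq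
  refine ⟨⟨?_, fun i => ?_, fun i j hij => ?_⟩, ?_⟩
  · ext i j
    fin_cases i <;> fin_cases j <;> simp [pairMatrix]
  · fin_cases i <;> simpa [pairMatrix] using hdiag
  · fin_cases i <;> fin_cases j <;> simp_all [pairMatrix]
  · refine largestEigenvalue_eq_one (v := ![q, (‖q‖ : ℂ)])
      (fun h => hq (by simpa using congrFun h 0)) ?_ fun i => ?_
    · have hqq : star q * q = (‖q‖ : ℂ) * ‖q‖ := by
        rw [Complex.star_def, ← Complex.normSq_eq_conj_mul_self, Complex.normSq_eq_norm_sq]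
        push_cast
        ring
      funext i
      fin_cases i
      · simp only [pairMatrix, mulVec, dotProduct, Fin.sum_univ_two]
        simp only [Fin.zero_eta, of_apply, cons_val_zero, cons_val_one, cons_val']
        linear_combination q * hpq'
      · simp only [pairMatrix, mulVec, dotProduct, Fin.sum_univ_two]
        simp only [Fin.mk_one, of_apply, cons_val_zero, cons_val_one, cons_val']
        rw [hqq]
        linear_combination (‖q‖ : ℂ) * hpq'
    · fin_cases i
      · simp [pairMatrix, Fin.sum_univ_two, abs_of_nonneg hp, hpq]
      · simp [pairMatrix, Fin.sum_univ_two, abs_of_nonneg hp, add_comm, hpq]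

theorem cost_pairMatrix {p : ℝ} {q : ℂ} (hp : 0 ≤ p) :
    cost α a b (pairMatrix p q) = 2 * (b * p ^ α) + a * ‖q‖ ^ α := by
  have h0 : Ioi (0 : Fin 2) = {1} := rfl
  have h1 : Ioi (1 : Fin 2) = ∅ := rfl
  simp only [cost, Fin.sum_univ_two, h0, h1, sum_singleton, sum_empty]
  simp [pairMatrix, abs_of_nonneg hp]
  ring

theorem cost_B_one : cost α a b (B 1 1 0) = b := by
  rw [cost_B le_rfl zero_le_one le_rfl (by norm_num)]
  simp

theorem B_one_mem_feasible (h1 : 1 ∈ ν₁.support) : B 1 1 0 ∈ feasible ν₁ ν₂ 1 :=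
  B_mem_feasible le_rfl zero_le_one le_rfl (by norm_num) (Or.inr h1) (Or.inl rfl)

/-- There is a feasible matrix of cost `a`, supported off the diagonal. -/
theorem exists_feasible_cost_eq (hα : 0 < α) [IsProbabilityMeasure ν₂] :
    ∃ A ∈ feasible ν₁ ν₂ 2, cost α a b A = a := by
  obtain ⟨u, hu⟩ := Measure.nonempty_support (IsProbabilityMeasure.ne_zero ν₂)
  have hn : ‖(u : ℂ)‖ = 1 := norm_eq_of_mem_sphere u
  refine ⟨pairMatrix 0 u, pairMatrix_mem_feasible le_rfl ?_ (by rw [hn, zero_add]) (Or.inl rfl)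
    (angleIn_coe u hu), ?_⟩
  · rw [← norm_pos_iff, hn]
    exact one_pos
  · rw [cost_pairMatrix le_rfl, hn, Real.zero_rpow hα.ne', Real.one_rpow]
    ring

/-- Common end of the two cases attained by some `B n s t`: `m` is the least admissible size (1, or
2 when the diagonal is 0) and `f` the cost as a function of the size. -/
theorem isLeast_cost_B {s t x₀ : ℝ} {m : ℕ} {f : ℝ → ℝ} (hm : 1 ≤ m) (ha : 0 ≤ a) (hb : 0 ≤ b)
    (hfeas : ∀ n : ℕ, m ≤ n → B n s t ∈ feasible ν₁ ν₂ n)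
    (hcost : ∀ n : ℕ, m ≤ n → cost α a b (B n s t) = f n)
    (hlow : ∀ (n : ℕ) (A : Matrix (Fin n) (Fin n) ℂ), A ∈ feasible ν₁ ν₂ n →
      ∃ k : ℕ, m ≤ k ∧ f k ≤ cost α a b A)
    (hceil : (m : ℤ) ≤ ⌈x₀⌉)
    (hmin : ∀ k : ℤ, (m : ℤ) ≤ k → min (f (max (m : ℤ) ⌊x₀⌋ : ℤ)) (f (⌈x₀⌉ : ℤ)) ≤ f k) :
    IsLeast {r : ℝ | ∃ n : ℕ, m ≤ n ∧ r = cost α a b (B n s t)} (rateConst α a b ν₁ ν₂) ∧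
      rateConst α a b ν₁ ν₂ = min (f (max (m : ℤ) ⌊x₀⌋ : ℤ)) (f (⌈x₀⌉ : ℤ)) := by
  have hup : ∀ n : ℕ, m ≤ n → rateConst α a b ν₁ ν₂ ≤ f n := fun n hn =>
    (rateConst_le ha hb (hm.trans hn) (hfeas n hn)).trans (hcost n hn).le
  have hupz : ∀ k : ℤ, (m : ℤ) ≤ k → rateConst α a b ν₁ ν₂ ≤ f k := fun k hk => by
    lift k to ℕ using le_trans (by positivity) hk
    exact_mod_cast hup k (by exact_mod_cast hk)
  have heq : rateConst α a b ν₁ ν₂ = min (f (max (m : ℤ) ⌊x₀⌋ : ℤ)) (f (⌈x₀⌉ : ℤ)) := by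
    refine le_antisymm (le_min (hupz _ (le_max_left _ _)) (hupz _ hceil))
      (le_rateConst hm (hfeas m le_rfl) fun n A hA => ?_)
    obtain ⟨k, hk, hkA⟩ := hlow n A hA
    exact (hmin k (by exact_mod_cast hk)).trans (by exact_mod_cast hkA)
  have hatt : ∃ k : ℤ, (m : ℤ) ≤ k ∧ rateConst α a b ν₁ ν₂ = f k := by
    rcases min_choice (f (max (m : ℤ) ⌊x₀⌋ : ℤ)) (f (⌈x₀⌉ : ℤ)) with h | h
    · exact ⟨_, le_max_left _ _, heq.trans h⟩
    · exact ⟨_, hceil, heq.trans h⟩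
  refine ⟨⟨?_, ?_⟩, heq⟩
  · obtain ⟨k, hk, hkeq⟩ := hatt
    lift k to ℕ using le_trans (by positivity) hk
    have hk' : m ≤ k := by exact_mod_cast hk
    exact ⟨k, hk', by rw [hcost k hk', hkeq]; norm_cast⟩
  · rintro r ⟨n, hn, rfl⟩
    rw [hcost n hn]
    exact hup n hn

/-! ### The six cases -/

theorem rateConst_of_le_one [IsProbabilityMeasure ν₂] (hα0 : 0 < α) (hα1 : α ≤ 1) (ha : 0 < a)
    (hb : 0 < b) :
    (1 ∈ ν₁.support → rateConst α a b ν₁ ν₂ = min b a) ∧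
      (1 ∉ ν₁.support → rateConst α a b ν₁ ν₂ = a) := by
  obtain ⟨A, hA, hAcost⟩ := exists_feasible_cost_eq (ν₁ := ν₁) (ν₂ := ν₂) (a := a) (b := b) hα0
  have hle : rateConst α a b ν₁ ν₂ ≤ a := (rateConst_le ha.le hb.le one_le_two hA).trans hAcost.le
  refine ⟨fun h1 => le_antisymm (le_min ?_ hle) ?_, fun h1 => le_antisymm hle ?_⟩
  · exact (rateConst_le ha.le hb.le le_rfl (B_one_mem_feasible h1)).trans cost_B_one.le
  · exact le_rateConst one_le_two hA fun n A' hA' => le_cost_of_le_one hα0 hα1 ha hb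
      (lt_min hb ha) (min_le_right _ _) (Or.inl (min_le_left _ _)) hA'
  · exact le_rateConst one_le_two hA fun n A' hA' => le_cost_of_le_one hα0 hα1 ha hb
      ha le_rfl (Or.inr h1) hA'

theorem rateConst_of_le_half (hα : 1 < α) (hα2 : α < 2) (ha : 0 < a) (hb : 0 < b)
    (h1 : 1 ∈ ν₁.support) (hab : b ≤ a / 2) : rateConst α a b ν₁ ν₂ = b :=
  le_antisymm
    ((rateConst_le ha.le hb.le le_rfl (B_one_mem_feasible h1)).trans cost_B_one.le)
    (le_rateConst le_rfl (B_one_mem_feasible h1) fun _ _ hA =>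
      le_cost_of_le_half hα hα2 ha hb hab hA)

theorem rateConst_of_half_lt (hα : 1 < α) (hα2 : α < 2) (ha : 0 < a)
    (h12 : 1 ∈ ν₁.support ∩ ν₂.support) (hab : a / 2 < b) :
    (∀ n : ℕ, 1 ≤ n →
      B n ((1 / b) ^ (1 / (α - 1))) ((2 / a) ^ (1 / (α - 1))) ∈ feasible ν₁ ν₂ n) ∧
    IsLeast {r : ℝ | ∃ n : ℕ, 1 ≤ n ∧
      r = cost α a b (B n ((1 / b) ^ (1 / (α - 1))) ((2 / a) ^ (1 / (α - 1))))}
      (rateConst α a b ν₁ ν₂) ∧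
    rateConst α a b ν₁ ν₂ =
      min (psi α a b (max 1 ⌊tZero α a b⌋ : ℤ)) (psi α a b (⌈tZero α a b⌉ : ℤ)) := by
  have hb : 0 < b := by linarith
  have hα1 : 0 < α - 1 := by linarith
  have hs : 0 < (1 / b) ^ (1 / (α - 1)) := by positivity
  have ht : 0 < (2 / a) ^ (1 / (α - 1)) := by positivity
  have hst := weights_lt hα ha hab
  have hx₀ : tZero α a b = 1 / (1 - (α - 1)) *
      (1 - (1 / b) ^ (1 / (α - 1)) / (2 / a) ^ (1 / (α - 1))) := by
    rw [tZero, ← Real.div_rpow (by positivity) (by positivity),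
      show 1 / b / (2 / a) = a / (2 * b) by field_simp, show 1 - (α - 1) = 2 - α by ring]
  set s := (1 / b) ^ (1 / (α - 1)) with hs_def
  set t := (2 / a) ^ (1 / (α - 1)) with ht_def
  have hD : ∀ n : ℕ, 1 ≤ n → 0 < s + ((n : ℝ) - 1) * t := fun n hn => by
    have : (1 : ℝ) ≤ n := by exact_mod_cast hn
    exact add_pos_of_pos_of_nonneg hs (mul_nonneg (by linarith) ht.le)
  have hfeas : ∀ n : ℕ, 1 ≤ n → B n s t ∈ feasible ν₁ ν₂ n := fun n hn =>
    B_mem_feasible hn hs.le ht.le (hD n hn) (Or.inr h12.1) (Or.inr h12.2)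
  have hceil : 1 ≤ ⌈tZero α a b⌉ := by
    rw [Int.one_le_ceil_iff, hx₀]
    exact mul_pos (one_div_pos.2 (by linarith)) (sub_pos.2 ((div_lt_one ht).2 hst))
  refine ⟨hfeas, isLeast_cost_B (f := psi α a b) (m := 1) le_rfl ha.le hb.le hfeas
    (fun n hn => ?_) (fun n A hA => exists_profile_le_cost hα hα2 ha hab hA)
    hceil fun k hk => ?_⟩
  · rw [cost_B hn hs.le ht.le (hD n hn), mul_rpow_weight hα hb, mul_rpow_half_weight hα ha]
    exact div_rpow_eq_profile (hD n hn)
  · exact min_profile_le (ε := α - 1) ht (by linarith) hx₀ (by simpa using hs) hceil hk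

theorem rateConst_of_half_lt_neg (hα : 1 < α) (hα2 : α < 2) (ha : 0 < a)
    (h1 : 1 ∈ ν₁.support) (h2 : ν₂.support = {-1}) (hab : a / 2 < b) :
    rateConst α a b ν₁ ν₂ =
      min b (2 / ((1 / b) ^ (1 / (α - 1)) + (2 / a) ^ (1 / (α - 1))) ^ (α - 1)) := by
  have hb : 0 < b := by linarith
  have hα1 : 0 < α - 1 := by linarith
  have e1 : profile ((1 / b) ^ (1 / (α - 1))) ((2 / a) ^ (1 / (α - 1))) (α - 1) (1 : ℕ) = b := by
    rw [profile, Nat.cast_one, sub_self, zero_mul, add_zero, one_div_rpow_inv_rpow hb hα1.ne',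
      one_div_one_div]
  have e2 : profile ((1 / b) ^ (1 / (α - 1))) ((2 / a) ^ (1 / (α - 1))) (α - 1) (2 : ℕ) =
      2 / ((1 / b) ^ (1 / (α - 1)) + (2 / a) ^ (1 / (α - 1))) ^ (α - 1) := by
    rw [profile, Nat.cast_ofNat, show (2 : ℝ) - 1 = 1 by norm_num, one_mul]
  refine le_antisymm (le_min ?_ ?_) ?_
  · exact (rateConst_le ha.le hb.le le_rfl (B_one_mem_feasible h1)).trans
      cost_B_one.le
  · have hs : 0 < (1 / b) ^ (1 / (α - 1)) := by positivity
    have ht : 0 < (2 / a) ^ (1 / (α - 1)) := by positivity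
    have hws := mul_rpow_weight hα hb
    have hwt := mul_rpow_half_weight hα ha
    rw [← e2]
    set s := (1 / b) ^ (1 / (α - 1))
    set t := (2 / a) ^ (1 / (α - 1))
    have hD : 0 < s + ((2 : ℕ) - 1 : ℝ) * t := by
      norm_num
      positivity
    have hst : s + ((2 : ℕ) - 1 : ℝ) * t = s + t := by norm_num
    have hq : ‖-((t / (s + t) : ℝ) : ℂ)‖ = t / (s + t) := by
      rw [norm_neg, Complex.norm_real, Real.norm_of_nonneg (by positivity)]
    -- This is `B 2 s t` with the off-diagonal sign reversed; the cost sees only the moduli.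
    have hmem : pairMatrix (s / (s + t)) (-((t / (s + t) : ℝ) : ℂ)) ∈ feasible ν₁ ν₂ 2 := by
      refine pairMatrix_mem_feasible (by positivity) ?_ ?_ (Or.inr h1)
        (angleIn_neg_ofReal (by rw [h2]; rfl) (by positivity))
      · rw [← norm_pos_iff, hq]
        positivity
      · rw [hq, ← add_div, div_self (by positivity)]
    refine (rateConst_le ha.le hb.le one_le_two hmem).trans (le_of_eq ?_)
    rw [cost_pairMatrix (by positivity), hq, ← div_rpow_eq_profile hD, hst,
      Real.div_rpow hs.le (by positivity), Real.div_rpow ht.le (by positivity)]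
    push_cast
    rw [show 2 * (b * (s ^ α / (s + t) ^ α)) + a * (t ^ α / (s + t) ^ α) =
      (2 * (b * s ^ α) + 2 * (a / 2 * t ^ α)) / (s + t) ^ α by ring, hws, hwt, mul_add]
  · refine le_rateConst le_rfl (B_one_mem_feasible h1) fun n A hA => ?_
    obtain ⟨k, hk, hk2, hkle⟩ := exists_le_two_profile_le_cost hα hα2 ha hab h2 hA
    refine le_trans ?_ hkle
    obtain rfl | rfl : k = 1 ∨ k = 2 := by omega
    · rw [e1]
      exact min_le_left _ _
    · rw [e2]
      exact min_le_right _ _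

theorem rateConst_of_neg (hα : 1 < α) (hα2 : α < 2) (ha : 0 < a) (hb : 0 < b)
    (h1 : 1 ∉ ν₁.support) (h2 : 1 ∈ ν₂.support) :
    (∀ n : ℕ, 2 ≤ n → B n 0 1 ∈ feasible ν₁ ν₂ n) ∧
    IsLeast {r : ℝ | ∃ n : ℕ, 2 ≤ n ∧ r = cost α a b (B n 0 1)} (rateConst α a b ν₁ ν₂) ∧
    rateConst α a b ν₁ ν₂ =
      a / 2 * min (phi α (max 2 ⌊tOne α⌋ : ℤ)) (phi α (⌈tOne α⌉ : ℤ)) := by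
  have hα1 : 0 < α - 1 := by linarith
  have hphi : ∀ x, phi α x = profile 0 1 (α - 1) x := fun x => by
    rw [phi, profile, zero_add, mul_one]
  have hD : ∀ n : ℕ, 2 ≤ n → 0 < (0 : ℝ) + ((n : ℝ) - 1) * 1 := fun n hn => by
    have : (2 : ℝ) ≤ n := by exact_mod_cast hn
    linarith
  have hfeas : ∀ n : ℕ, 2 ≤ n → B n 0 1 ∈ feasible ν₁ ν₂ n := fun n hn =>
    B_mem_feasible (by omega) le_rfl zero_le_one (hD n hn) (Or.inl rfl) (Or.inr h2)
  have hx₀ : tOne α = 1 / (1 - (α - 1)) * (1 - 0 / 1) := by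
    rw [tOne]
    ring
  have hceil : 2 ≤ ⌈tOne α⌉ := by
    rw [show (2 : ℤ) = 1 + 1 from rfl, Int.add_one_le_iff, Int.lt_ceil, tOne,
      Int.cast_one, one_lt_div (by linarith)]
    linarith
  rw [mul_min_of_nonneg _ _ (half_pos ha).le]
  refine ⟨hfeas, isLeast_cost_B (f := fun x => a / 2 * phi α x) (m := 2) one_le_two ha.le hb.le
    hfeas (fun n hn => ?_) (fun n A hA => ?_) hceil fun k hk => ?_⟩
  · have h0 : (0 : ℝ) ^ α = 0 := Real.zero_rpow (by linarith)
    rw [cost_B (by omega) le_rfl zero_le_one (hD n hn), hphi, ← div_rpow_eq_profile (hD n hn), h0,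
      Real.one_rpow]
    ring
  · obtain ⟨k, hk, hkle⟩ := exists_profile_zero_le_cost hα hα2 ha hb h1 hA
    refine ⟨k, hk, le_trans (le_of_eq ?_) hkle⟩
    have hk1 : (0 : ℝ) ≤ (k : ℝ) - 1 := by
      have : (2 : ℝ) ≤ k := by exact_mod_cast hk
      linarith
    -- With `s = 0` the coefficient `t` factors out of the profile as `t ^ (α - 1) = 2 / a`, which
    -- leaves `a / 2 * phi`.
    rw [phi, profile, zero_add, Real.mul_rpow hk1 (by positivity),
      ← Real.rpow_mul (by positivity), one_div_mul_cancel hα1.ne', Real.rpow_one]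
    field_simp
  · rw [← mul_min_of_nonneg _ _ (half_pos ha).le, hphi, hphi, hphi]
    exact mul_le_mul_of_nonneg_left
      (min_profile_le one_pos (by linarith) hx₀ (by norm_num) hceil hk) (half_pos ha).le

theorem rateConst_of_neg_neg [IsProbabilityMeasure ν₂] (hα : 1 < α) (hα2 : α < 2) (ha : 0 < a)
    (hb : 0 < b) (h1 : 1 ∉ ν₁.support) (h2 : ν₂.support = {-1}) :
    rateConst α a b ν₁ ν₂ = a := by
  obtain ⟨A, hA, hAcost⟩ := exists_feasible_cost_eq (ν₁ := ν₁) (ν₂ := ν₂) (a := a) (b := b)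
    (by linarith : 0 < α)
  exact le_antisymm ((rateConst_le ha.le hb.le one_le_two hA).trans hAcost.le)
    (le_rateConst one_le_two hA fun _ _ hA' => le_cost_of_neg_neg hα hα2 ha hb h1 h2 hA')

theorem one_notMem_of_support_eq {ν : Measure UnitCircle} (h : ν.support = {-1}) :
    1 ∉ ν.support := by
  rw [h, Set.mem_singleton_iff]
  intro h1
  have h2 : (1 : ℂ) = -1 := congrArg Subtype.val h1
  norm_num at h2

end TopEigenvalue

theorem mainTheorem2 (α a b : ℝ) (hα0 : 0 < α) (hα2 : α < 2) (ha : 0 < a) (hb : 0 < b)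
    (ν₁ ν₂ : MeasureTheory.Measure TopEigenvalue.UnitCircle)
    [MeasureTheory.IsProbabilityMeasure ν₁] [MeasureTheory.IsProbabilityMeasure ν₂] :
    -- (a)
    (α ≤ 1 →
      (1 ∈ ν₁.support → TopEigenvalue.rateConst α a b ν₁ ν₂ = min b a) ∧
      (1 ∉ ν₁.support → TopEigenvalue.rateConst α a b ν₁ ν₂ = a)) ∧
    -- (b)
    (1 < α → 1 ∈ ν₁.support → b ≤ a / 2 → TopEigenvalue.rateConst α a b ν₁ ν₂ = b) ∧
    -- (c)
    (1 < α → 1 ∈ ν₁.support ∩ ν₂.support → a / 2 < b →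
      (∀ n : ℕ, 1 ≤ n →
        TopEigenvalue.B n ((1 / b) ^ (1 / (α - 1))) ((2 / a) ^ (1 / (α - 1))) ∈
          TopEigenvalue.feasible ν₁ ν₂ n) ∧
      IsLeast
        {r : ℝ | ∃ n : ℕ, 1 ≤ n ∧ r = TopEigenvalue.cost α a b
          (TopEigenvalue.B n ((1 / b) ^ (1 / (α - 1))) ((2 / a) ^ (1 / (α - 1))))}
        (TopEigenvalue.rateConst α a b ν₁ ν₂) ∧
      TopEigenvalue.rateConst α a b ν₁ ν₂ =
        min (TopEigenvalue.psi α a b (max 1 ⌊TopEigenvalue.tZero α a b⌋ : ℤ))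
          (TopEigenvalue.psi α a b (⌈TopEigenvalue.tZero α a b⌉ : ℤ))) ∧
    -- (d)
    (1 < α → 1 ∈ ν₁.support → ν₂.support = {-1} → a / 2 < b →
      TopEigenvalue.rateConst α a b ν₁ ν₂ =
        min b (2 / ((1 / b) ^ (1 / (α - 1)) + (2 / a) ^ (1 / (α - 1))) ^ (α - 1))) ∧
    -- (e)
    (1 < α → ν₁.support = {-1} → 1 ∈ ν₂.support →
      (∀ n : ℕ, 2 ≤ n → TopEigenvalue.B n 0 1 ∈ TopEigenvalue.feasible ν₁ ν₂ n) ∧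
      IsLeast
        {r : ℝ | ∃ n : ℕ, 2 ≤ n ∧ r = TopEigenvalue.cost α a b (TopEigenvalue.B n 0 1)}
        (TopEigenvalue.rateConst α a b ν₁ ν₂) ∧
      TopEigenvalue.rateConst α a b ν₁ ν₂ =
        a / 2 * min (TopEigenvalue.phi α (max 2 ⌊TopEigenvalue.tOne α⌋ : ℤ))
          (TopEigenvalue.phi α (⌈TopEigenvalue.tOne α⌉ : ℤ))) ∧
    -- (f)
    (1 < α → ν₁.support = {-1} → ν₂.support = {-1} →
      TopEigenvalue.rateConst α a b ν₁ ν₂ = a) := by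
  open TopEigenvalue in
  exact ⟨fun hα => rateConst_of_le_one hα0 hα ha hb,
    fun hα h1 hab => rateConst_of_le_half hα hα2 ha hb h1 hab,
    fun hα h12 hab => rateConst_of_half_lt hα hα2 ha h12 hab,
    fun hα h1 h2 hab => rateConst_of_half_lt_neg hα hα2 ha h1 h2 hab,
    fun hα h1 h2 => rateConst_of_neg hα hα2 ha hb (one_notMem_of_support_eq h1) h2,
    fun hα h1 h2 => rateConst_of_neg_neg hα hα2 ha hb (one_notMem_of_support_eq h1) h2⟩
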